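/- Let $n\ge 4$. Let $W=W(B_n)$ be the group of all permutations $w$ of $\{-n,\dots,n\}$ with $w(-i)=-w(i)$, and let $W^+=W(D_n)$ be the subgroup of those $w\in W$ for which the number of $i\in\{1,\dots,n\}$ with $w(i)<0$ is even. Write $(i_1,\dots,i_k)$ for the positive cycle $(i_1,\dots,i_k)(-i_1,\dots,-i_k)$ and $(i_1,\dots,i_k)^-$ for the negative cycle $(i_1,\dots,i_k,-i_1,\dots,-i_k)$. Let $S^+=\{u,s_1,\dots,s_{n-1}\}$ with $u=(1,-2)$ and $s_i=(i,i+1)$ be the set of Coxeter generators of $W^+$. Let $\lambda=(\lambda^+,\lambda^-)$ be a double partition of $n$, i.e. a pair of weakly increasing finite (possibly empty) sequences of positive integers with $|\lambda^+|+|\lambda^-|=n$, such that $\lambda^-$ has an even number of parts. Let $w_\lambda\in W^+$ be the signed permutation whose negative cycles, of lengths $\lambda^-_1,\lambda^-_2,\dots$ in this order, occupy the points $1,\dots,|\lambda^-|$, and whose positive cycles, of lengths $\lambda^+_1,\lambda^+_2,\dots$ in this order, occupy the points $|\lambda^-|+1,\dots,n$, each cycle consisting of consecutive numbers in increasing order.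 Let $J^+=J^+(w_\lambda)\subseteq S^+$ be the set of generators occurring in a reduced expression of $w_\lambda$ in the generators $S^+$, and let $W^+_{J^+}=\langle J^+\rangle$. Let $a_m$ be the multiplicity of $m$ as a part of $\lambda^+$, put $o_m=|\lambda^-|+a_1+2a_2+\dots+(m-1)a_{m-1}$, and for $o,m\ge 0$ put $$s(o,m)=(o+1,o+2,\dots,o+2m)^m,\qquad t(o,m)=(o+1)^-(o+2)^-\cdots(o+m)^-.$$ Let $$N_\lambda=\langle\, t(o_m,m),\ s(o_m+im,m)\ :\ i=0,\dots,a_m-2,\ m=1,\dots,n,\ a_m>0\,\rangle\le W.$$ Call a partition even if all of its parts are even (so the empty partition is even), and call a subgroup $N$ of a group $G$ a complement of a subgroup $H$ of $G$ if $H\cap N=1$ and $HN=G$. Then: (i) If $\lambda^+$ is even, then $N_\lambda$ is a complement of $C_{W^+_{J^+}}(w_\lambda)$ in $C_{W^+}(w_\lambda)$. (ii) If $\lambda^+$ is not even and $\lambda^-=\emptyset$, then $N_\lambda\cap W^+$ is a subgroup of index $2$ in $N_\lambda$ and a complement of $C_{W^+_{J^+}}(w_\lambda)$ in $C_{W^+}(w_\lambda)$.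 (iii) If $\lambda^-=(\lambda^-_1,\dots,\lambda^-_s)$ is not even, then there is an index $1\le j\le s$ such that $\lambda^-_1+\dots+\lambda^-_j$ is odd, and for every such $j$, with $k=\lambda^-_1+\dots+\lambda^-_j$, the subgroup $$N^+_\lambda=\langle\, t(0,k)^m\,t(o_m,m),\ s(o_m+im,m)\ :\ i=0,\dots,a_m-2,\ m=1,\dots,n,\ a_m>0\,\rangle$$ is a complement of $C_{W^+_{J^+}}(w_\lambda)$ in $C_{W^+}(w_\lambda)$. -/

import Mathlib

namespace SignedPerm

/-- The Coxeter group `W = W(B_n)`: the permutations `w` with `w (-i) = - w i` of the set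
`{-n, …, n}`, each one extended to `ℤ` by fixing every integer of absolute value `> n`. -/
noncomputable def groupB (n : ℕ) : Subgroup (Equiv.Perm ℤ) where
  carrier := {w | (∀ i, w (-i) = -w i) ∧ ∀ i : ℤ, (n : ℤ) < |i| → w i = i}
  one_mem' := ⟨fun _ => rfl, fun _ _ => rfl⟩
  mul_mem' := by
    rintro v w ⟨hv, hv'⟩ ⟨hw, hw'⟩
    refine ⟨fun i => ?_, fun i hi => ?_⟩
    · simp only [Equiv.Perm.mul_apply, hw, hv]
    · simp only [Equiv.Perm.mul_apply, hw' i hi, hv' i hi]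
  inv_mem' := by
    rintro w ⟨hw, hw'⟩
    refine ⟨fun i => ?_, fun i hi => ?_⟩
    · rw [Equiv.Perm.inv_eq_iff_eq, hw, ← Equiv.Perm.mul_apply, mul_inv_cancel,
        Equiv.Perm.one_apply]
    · rw [Equiv.Perm.inv_eq_iff_eq, hw' i hi]

/-- The set of those `i ∈ {1, …, n}` that `w` sends to a negative number. -/
noncomputable def negatives (n : ℕ) (w : Equiv.Perm ℤ) : Finset ℤ :=
  (Finset.Icc 1 (n : ℤ)).filter (fun i => w i < 0)

theorem apply_ne_zero {n : ℕ} {w : Equiv.Perm ℤ} (hw : w ∈ groupB n) {i : ℤ} (hi : i ≠ 0) :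
    w i ≠ 0 := by
  have h0 : w 0 = 0 := by
    have := hw.1 0
    rw [neg_zero] at this
    lia
  intro h
  exact hi (w.injective (h.trans h0.symm))

theorem abs_apply_mem {n : ℕ} {w : Equiv.Perm ℤ} (hw : w ∈ groupB n) {i : ℤ}
    (hi : i ∈ Finset.Icc 1 (n : ℤ)) : |w i| ∈ Finset.Icc 1 (n : ℤ) := by
  rw [Finset.mem_Icc] at hi ⊢
  refine ⟨Int.one_le_abs (apply_ne_zero hw (by lia)), ?_⟩
  by_contra hlt
  push Not at hlt
  have h1 := w.injective (hw.2 (w i) hlt)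
  rw [h1, abs_of_pos (by lia)] at hlt
  lia

theorem prod_sign_eq {n : ℕ} {w : Equiv.Perm ℤ} (hw : w ∈ groupB n) :
    ∏ i ∈ Finset.Icc 1 (n : ℤ), (w i).sign = (-1) ^ (negatives n w).card := by
  have h : ∀ i ∈ Finset.Icc 1 (n : ℤ), (w i).sign = if w i < 0 then -1 else 1 := by
    intro i hi
    rw [Finset.mem_Icc] at hi
    have h0 := apply_ne_zero hw (i := i) (by lia)
    split_ifs with hlt
    · exact Int.sign_eq_neg_one_of_neg hlt
    · exact Int.sign_eq_one_of_pos (by lia)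
  rw [Finset.prod_congr rfl h, Finset.prod_ite, Finset.prod_const, Finset.prod_const_one, mul_one]
  rfl

theorem prod_sign_mul {n : ℕ} {v w : Equiv.Perm ℤ} (hv : v ∈ groupB n) (hw : w ∈ groupB n) :
    ∏ i ∈ Finset.Icc 1 (n : ℤ), ((v * w) i).sign =
      (∏ i ∈ Finset.Icc 1 (n : ℤ), (v i).sign) * ∏ i ∈ Finset.Icc 1 (n : ℤ), (w i).sign := by
  have h1 : ∀ i ∈ Finset.Icc 1 (n : ℤ), ((v * w) i).sign = (v |w i|).sign * (w i).sign := by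
    intro i hi
    rw [Finset.mem_Icc] at hi
    have h0 := apply_ne_zero hw (i := i) (by lia)
    rw [Equiv.Perm.mul_apply]
    rcases lt_or_gt_of_ne h0 with h | h
    · rw [abs_of_neg h, hv.1, Int.sign_neg, Int.sign_eq_neg_one_of_neg h]
      ring
    · rw [abs_of_pos h, Int.sign_eq_one_of_pos h, mul_one]
  rw [Finset.prod_congr rfl h1, Finset.prod_mul_distrib]
  congr 1
  have hinj : Set.InjOn (fun i => |w i|) (Finset.Icc 1 (n : ℤ)) := by
    intro i hi j hj hij
    simp only [Finset.coe_Icc, Set.mem_Icc] at hi hj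
    rcases abs_eq_abs.1 hij with h | h
    · exact w.injective h
    · rw [← hw.1] at h
      have := w.injective h
      lia
  have himg : (Finset.Icc 1 (n : ℤ)).image (fun i => |w i|) = Finset.Icc 1 (n : ℤ) := by
    apply Finset.eq_of_subset_of_card_le
    · intro j hj
      obtain ⟨i, hi, rfl⟩ := Finset.mem_image.1 hj
      exact abs_apply_mem hw hi
    · rw [Finset.card_image_of_injOn hinj]
  conv_rhs => rw [← himg, Finset.prod_image hinj]

/-- The Coxeter group `W⁺ = W(D_n)`: the elements of `W(B_n)` for which the number of
`i ∈ {1, …, n}` with `w i < 0` is even. -/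
noncomputable def groupD (n : ℕ) : Subgroup (Equiv.Perm ℤ) where
  carrier := {w | w ∈ groupB n ∧ Even (negatives n w).card}
  one_mem' := by
    refine ⟨one_mem _, ?_⟩
    have : negatives n 1 = ∅ := by
      refine Finset.filter_false_of_mem fun i hi => ?_
      rw [Finset.mem_Icc] at hi
      rw [Equiv.Perm.one_apply]
      lia
    rw [this]
    exact Even.zero
  mul_mem' := by
    rintro v w ⟨hv, hv'⟩ ⟨hw, hw'⟩
    refine ⟨mul_mem hv hw, ?_⟩
    have h := prod_sign_mul hv hw
    rw [prod_sign_eq hv, prod_sign_eq hw, prod_sign_eq (mul_mem hv hw), hv'.neg_one_pow,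
      hw'.neg_one_pow, mul_one] at h
    exact (neg_one_pow_eq_one_iff_even (by norm_num)).1 h
  inv_mem' := by
    rintro w ⟨hw, hw'⟩
    refine ⟨inv_mem hw, ?_⟩
    have h := prod_sign_mul (inv_mem hw) hw
    have h1 : ∏ i ∈ Finset.Icc 1 (n : ℤ), ((w⁻¹ * w) i).sign = 1 := by
      apply Finset.prod_eq_one
      intro i hi
      rw [Finset.mem_Icc] at hi
      rw [inv_mul_cancel, Equiv.Perm.one_apply]
      exact Int.sign_eq_one_of_pos (by lia)
    rw [h1, prod_sign_eq hw, prod_sign_eq (inv_mem hw), hw'.neg_one_pow, mul_one] at h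
    exact (neg_one_pow_eq_one_iff_even (by norm_num)).1 h.symm

/-- The positive cycle `(i₁, …, i_k)`, i.e. `(i₁, …, i_k)(-i₁, …, -i_k)`. -/
def posCycle (l : List ℤ) : Equiv.Perm ℤ := l.formPerm * (l.map (fun i => -i)).formPerm

/-- The negative cycle `(i₁, …, i_k)⁻`, i.e. `(i₁, …, i_k, -i₁, …, -i_k)`. -/
def negCycle (l : List ℤ) : Equiv.Perm ℤ := (l ++ l.map (fun i => -i)).formPerm

/-- The list `o+1, …, o+m`. -/
def block (o m : ℕ) : List ℤ := (List.range m).map (fun i => (o : ℤ) + 1 + (i : ℤ))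

/-- The Coxeter generators of `W(D_n)`: `u = (1, -2)` and `s_i = (i, i+1)`, `1 ≤ i ≤ n - 1`. -/
def gensD (n : ℕ) : Set (Equiv.Perm ℤ) :=
  {g | g = posCycle [1, -2] ∨ ∃ i : ℕ, 1 ≤ i ∧ i + 1 ≤ n ∧ g = posCycle [(i : ℤ), (i : ℤ) + 1]}

/-- `l` is a reduced expression of `w` in the generators of `W(D_n)`. -/
def IsReducedExprD (n : ℕ) (w : Equiv.Perm ℤ) (l : List (Equiv.Perm ℤ)) : Prop :=
  (∀ g ∈ l, g ∈ gensD n) ∧ l.prod = w ∧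
    ∀ l' : List (Equiv.Perm ℤ), (∀ g ∈ l', g ∈ gensD n) → l'.prod = w → l.length ≤ l'.length

/-- `J⁺(w)`: the generators of `W(D_n)` that occur in a reduced expression of `w`. -/
def supportD (n : ℕ) (w : Equiv.Perm ℤ) : Set (Equiv.Perm ℤ) :=
  {g | ∃ l, IsReducedExprD n w l ∧ g ∈ l}

/-- `W⁺_{J⁺}` for `J⁺ = J⁺(w)`: the standard parabolic subgroup of `W(D_n)` generated by
`J⁺(w)`. -/
def parabolicD (n : ℕ) (w : Equiv.Perm ℤ) : Subgroup (Equiv.Perm ℤ) :=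
  Subgroup.closure (supportD n w)

/-- `C_H(w)`, the centralizer of `w` in the subgroup `H`. -/
def centralizerIn (H : Subgroup (Equiv.Perm ℤ)) (w : Equiv.Perm ℤ) : Subgroup (Equiv.Perm ℤ) :=
  H ⊓ Subgroup.centralizer {w}

/-- `N` is a complement of the subgroup `H` in the group `G`: both are subgroups of `G`, and every
element of `G` is a product `h x` with unique `h ∈ H` and `x ∈ N`. -/
def IsComplementIn (N H G : Subgroup (Equiv.Perm ℤ)) : Prop :=
  H ≤ G ∧ N ≤ G ∧ (H.subgroupOf G).IsComplement' (N.subgroupOf G)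

/-- A double partition `(λ⁺, λ⁻)` of `n`: a pair of weakly increasing sequences of positive
integers whose sums add up to `n`. -/
structure DoublePartition (n : ℕ) where
  pos : List ℕ
  neg : List ℕ
  pos_sorted : pos.Pairwise (· ≤ ·)
  neg_sorted : neg.Pairwise (· ≤ ·)
  pos_parts : ∀ m ∈ pos, 0 < m
  neg_parts : ∀ m ∈ neg, 0 < m
  sum_eq : pos.sum + neg.sum = n

/-- A partition is even if it consists of even parts only. -/
def EvenParts (l : List ℕ) : Prop := ∀ m ∈ l, Even m

/-- The product of cycles of type `c` on successive blocks of consecutive points, of the given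
lengths, starting after the offset `o`. -/
def cycleProd (c : List ℤ → Equiv.Perm ℤ) : ℕ → List ℕ → Equiv.Perm ℤ
  | _, [] => 1
  | o, m :: l => c (block o m) * cycleProd c (o + m) l

/-- `s(o, m) = (o+1, …, o+2m)^m`, which swaps the blocks `o+1, …, o+m` and `o+m+1, …, o+2m`. -/
def blockSwap (o m : ℕ) : Equiv.Perm ℤ := posCycle (block o (2 * m)) ^ m

/-- `t(o, m) = (o+1)⁻ (o+2)⁻ ⋯ (o+m)⁻`. -/
def blockNeg (o m : ℕ) : Equiv.Perm ℤ := ((block o m).map (fun i => negCycle [i])).prod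

namespace DoublePartition

variable {n : ℕ}

/-- The representative `w_λ`: its negative cycles are on the points `1, …, |λ⁻|`, its positive
cycles on the points `|λ⁻|+1, …, n`, and each cycle consists of consecutive numbers in increasing
order. -/
def rep (lam : DoublePartition n) : Equiv.Perm ℤ :=
  cycleProd negCycle 0 lam.neg * cycleProd posCycle lam.neg.sum lam.pos

/-- `a_m`, the multiplicity of `m` as a part of `λ⁺`. -/
def mult (lam : DoublePartition n) (m : ℕ) : ℕ := lam.pos.count m

/-- The offset `o_m = |λ⁻| + a_1 + 2 a_2 + ⋯ + (m-1) a_{m-1}`. -/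
def offset (lam : DoublePartition n) (m : ℕ) : ℕ :=
  lam.neg.sum + ∑ i ∈ Finset.range m, i * lam.mult i

/-- The group `N_λ` generated by all `t(o_m, m)` and `s(o_m + i m, m)`, `0 ≤ i ≤ a_m - 2`, for
`1 ≤ m ≤ n` with `a_m > 0`. -/
def groupN (lam : DoublePartition n) : Subgroup (Equiv.Perm ℤ) :=
  Subgroup.closure {g | ∃ m : ℕ, 1 ≤ m ∧ m ≤ n ∧ 0 < lam.mult m ∧
    (g = blockNeg (lam.offset m) m ∨
      ∃ i : ℕ, i + 2 ≤ lam.mult m ∧ g = blockSwap (lam.offset m + i * m) m)}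

/-- The group `N⁺_λ` generated by all `t(0, k)^m t(o_m, m)` and `s(o_m + i m, m)`,
`0 ≤ i ≤ a_m - 2`, for `1 ≤ m ≤ n` with `a_m > 0`. -/
def groupNPlus (lam : DoublePartition n) (k : ℕ) : Subgroup (Equiv.Perm ℤ) :=
  Subgroup.closure {g | ∃ m : ℕ, 1 ≤ m ∧ m ≤ n ∧ 0 < lam.mult m ∧
    (g = blockNeg 0 k ^ m * blockNeg (lam.offset m) m ∨
      ∃ i : ℕ, i + 2 ≤ lam.mult m ∧ g = blockSwap (lam.offset m + i * m) m)}

/-- `λ⁻_1 + ⋯ + λ⁻_j`. -/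
def negPartialSum (lam : DoublePartition n) (j : ℕ) : ℕ := (lam.neg.take j).sum

end DoublePartition

end SignedPerm

namespace SignedPerm

/-! All three cases follow from one analysis of the groups `groupNPlus k`. For `k = 0` the factor
`t(0,0)` is trivial and the group is `N_λ`; for odd `k` it is `N⁺_λ`.

The parabolic subgroup is identified first. Length in `W(D_n)` is the number of inverted positive
roots. A subgroup containing the simple reflection at every descent of each of its elements is
therefore generated by its simple reflections, and it contains every letter of every reduced word of
its elements. Applied to `w_λ`, this shows that `W⁺_{J⁺}` is the subgroup of `W(D_n)` stabilising
each half-line `{x > c}`, where `c` runs through the end of the negative part and the ends of the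
positive cycles (`parabolicD_rep`).

A point `x` of a negative cycle has `-x` in its `w_λ`-orbit, and a point of a positive cycle does
not. So an element `g` of the centralizer permutes the positive cycles of each length up to sign
(`exists_block_of_commute`). Going down from the last positive cycle, block swaps and sign changes
from `N` put each block back in its place (`exists_mul_mem_setStab`), so `q * g` stabilises all cuts
for some `q ∈ N`.

For the trivial intersection, `N` centralizes `w_λ`, permutes the first points of the positive
cycles up to sign, and acts on the negative part only through the powers of `t(0,k)`. An element of
`N` stabilising all cuts fixes every first point, hence every positive cycle pointwise, so it is `1`
or `t(0,k)`; for odd `k` the latter lies outside `W(D_n)` (`eq_one_of_mem`).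

Membership in `W(D_n)` is governed by the sign character. The generators of `N` are even if `λ⁺` is
even and `k = 0`, or if `k` is odd, because `t(0,k)^m t(o_m,m)` has sign `(-1)^(km+m)`. If `λ⁻` is
empty, every element stabilising the cuts preserves positivity, so the correcting `q` has the same
sign as `g`. -/

theorem groupB_ext {n : ℕ} {g h : Equiv.Perm ℤ} (hg : g ∈ groupB n) (hh : h ∈ groupB n)
    (H : ∀ x : ℤ, 1 ≤ x → x ≤ n → g x = h x) : g = h := by
  have h0 : ∀ f ∈ groupB n, f 0 = 0 := by
    intro f hf
    have := hf.1 0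
    rw [neg_zero] at this
    lia
  have key : ∀ x : ℤ, 0 ≤ x → g x = h x := by
    intro x hx
    rcases hx.eq_or_lt with rfl | hx
    · rw [h0 g hg, h0 h hh]
    · by_cases hn : x ≤ n
      · exact H x hx hn
      · have : (n : ℤ) < |x| := by rw [abs_of_pos hx]; lia
        rw [hg.2 x this, hh.2 x this]
  ext x
  rcases le_total 0 x with hx | hx
  · exact key x hx
  · have := key (-x) (by lia)
    rw [hg.1, hh.1] at this
    lia

/-! ### Simple reflections of type D -/

theorem posCycle_pair_apply {a b : ℤ} (ha : a ≠ 0) (hb : b ≠ 0) (h2 : a ≠ -b)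
    (x : ℤ) :
    posCycle [a, b] x = if x = a then b else if x = b then a else if x = -a then -b else
      if x = -b then -a else x := by
  simp only [posCycle, List.map_cons, List.map_nil, List.formPerm_pair, Equiv.Perm.mul_apply,
    Equiv.swap_apply_def]
  split_ifs <;> lia

/-- `e_b - e_a` is a simple root of type `D_n` (where `e_{-1} = -e_1`). -/
def IsSimpleRoot (n : ℕ) (a b : ℤ) : Prop :=
  (a = -1 ∧ b = 2 ∧ b ≤ n) ∨ (1 ≤ a ∧ b = a + 1 ∧ b ≤ n)

theorem IsSimpleRoot.apply {n : ℕ} {a b : ℤ} (h : IsSimpleRoot n a b) (x : ℤ) :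
    posCycle [a, b] x = if x = a then b else if x = b then a else if x = -a then -b else
      if x = -b then -a else x := by
  unfold IsSimpleRoot at h
  apply posCycle_pair_apply <;> lia

theorem IsSimpleRoot.mul_self {n : ℕ} {a b : ℤ} (h : IsSimpleRoot n a b) :
    posCycle [a, b] * posCycle [a, b] = 1 := by
  ext x
  rw [Equiv.Perm.mul_apply, h.apply, h.apply, Equiv.Perm.one_apply]
  unfold IsSimpleRoot at h
  split_ifs <;> lia

theorem IsSimpleRoot.mem_groupD {n : ℕ} {a b : ℤ} (h : IsSimpleRoot n a b) :
    posCycle [a, b] ∈ groupD n := by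
  have hB : posCycle [a, b] ∈ groupB n := by
    refine ⟨fun i => ?_, fun i hi => ?_⟩
    · rw [h.apply, h.apply]
      unfold IsSimpleRoot at h
      split_ifs <;> lia
    · rw [h.apply]
      unfold IsSimpleRoot at h
      rw [lt_abs] at hi
      split_ifs <;> lia
  refine ⟨hB, ?_⟩
  rcases id h with ⟨rfl, rfl, hb⟩ | ⟨ha, rfl, hb⟩
  · have : negatives n (posCycle [-1, 2]) = {1, 2} := by
      ext x
      simp only [negatives, Finset.mem_filter, Finset.mem_Icc, h.apply, Finset.mem_insert,
        Finset.mem_singleton]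
      split_ifs <;> lia
    rw [this]
    decide
  · have : negatives n (posCycle [a, a + 1]) = ∅ := by
      refine Finset.filter_false_of_mem fun x hx => ?_
      rw [Finset.mem_Icc] at hx
      rw [h.apply]
      split_ifs <;> lia
    rw [this]
    exact Even.zero

/-- The generator `u` is written with the pair `(-1, 2)` rather than `(1, -2)`, so that for every
simple reflection a descent of `w` reads `w b < w a`. -/
theorem mem_gensD_iff {n : ℕ} (hn : 2 ≤ n) {g : Equiv.Perm ℤ} :
    g ∈ gensD n ↔ ∃ a b, IsSimpleRoot n a b ∧ g = posCycle [a, b] := by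
  have hu : posCycle [1, -2] = posCycle [-1, 2] := by
    ext x
    rw [posCycle_pair_apply (by lia) (by lia) (by lia),
      posCycle_pair_apply (by lia) (by lia) (by lia)]
    split_ifs <;> lia
  constructor
  · rintro (rfl | ⟨i, hi, hin, rfl⟩)
    · exact ⟨-1, 2, Or.inl ⟨rfl, rfl, by lia⟩, hu⟩
    · exact ⟨i, i + 1, Or.inr ⟨by lia, rfl, by lia⟩, rfl⟩
  · rintro ⟨a, b, ⟨rfl, rfl, hb⟩ | ⟨ha, rfl, hb⟩, rfl⟩
    · exact Or.inl hu.symm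
    · lift a to ℕ using by lia
      exact Or.inr ⟨a, by lia, by lia, rfl⟩

/-! ### Inversions and the length function -/

/-- The positive roots `e_b - e_a` of type `D_n`, as pairs `(a, b)` with `0 < |a| < b`. -/
noncomputable def posRoots (n : ℕ) : Finset (ℤ × ℤ) :=
  (Finset.Icc (-(n : ℤ)) n ×ˢ Finset.Icc 1 (n : ℤ)).filter
    fun p => p.1 ≠ 0 ∧ -p.2 < p.1 ∧ p.1 < p.2

theorem mem_posRoots {n : ℕ} {p : ℤ × ℤ} :
    p ∈ posRoots n ↔ p.1 ≠ 0 ∧ -p.2 < p.1 ∧ p.1 < p.2 ∧ p.2 ≤ n := by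
  simp only [posRoots, Finset.mem_filter, Finset.mem_product, Finset.mem_Icc]
  lia

/-- The number of positive roots made negative by `w`. -/
noncomputable def invCount (n : ℕ) (w : Equiv.Perm ℤ) : ℕ :=
  ((posRoots n).filter fun p => w p.2 < w p.1).card

theorem invCount_eq_erase {n : ℕ} (w : Equiv.Perm ℤ) {a b : ℤ} (h : IsSimpleRoot n a b) :
    invCount n w = (((posRoots n).erase (a, b)).filter fun p => w p.2 < w p.1).card +
      if w b < w a then 1 else 0 := by
  have hmem : (a, b) ∈ posRoots n := by
    rw [mem_posRoots]
    unfold IsSimpleRoot at h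
    lia
  unfold invCount
  conv_lhs => rw [← Finset.insert_erase hmem, Finset.filter_insert]
  split_ifs with hlt
  · rw [Finset.card_insert_of_notMem]
    simp
  · simp

/-- The permutation of the positive roots other than `e_b - e_a` induced by the reflection. -/
def reflRoot (a b : ℤ) (p : ℤ × ℤ) : ℤ × ℤ :=
  if posCycle [a, b] p.1 = -p.2 then p else (posCycle [a, b] p.1, posCycle [a, b] p.2)

/-- The pairs `(c, d)` and `(-d, -c)` stand for the same root. The reflection acts coordinatewise
and keeps the normal form `0 < |c| < d`, except when it turns `(c, d)` into `(-d, -c)`; that root is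
fixed, which is why `reflRoot` has a separate branch. -/
theorem reflRoot_mem {n : ℕ} {a b : ℤ} (h : IsSimpleRoot n a b) {p : ℤ × ℤ}
    (hp : p ∈ (posRoots n).erase (a, b)) : reflRoot a b p ∈ (posRoots n).erase (a, b) := by
  rcases p with ⟨c, d⟩
  rw [reflRoot]
  split_ifs with h0
  · exact hp
  · rw [Finset.mem_erase, mem_posRoots, ne_eq, Prod.mk.injEq] at hp ⊢
    dsimp only at h0 hp ⊢
    rw [h.apply] at h0 ⊢
    rw [h.apply]
    unfold IsSimpleRoot at h
    split_ifs at h0 ⊢ <;> lia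

theorem reflRoot_reflRoot {n : ℕ} {a b : ℤ} (h : IsSimpleRoot n a b) (p : ℤ × ℤ) :
    reflRoot a b (reflRoot a b p) = p := by
  have hs : ∀ x, posCycle [a, b] (posCycle [a, b] x) = x := fun x => by
    rw [← Equiv.Perm.mul_apply, h.mul_self, Equiv.Perm.one_apply]
  have hneg : ∀ x, posCycle [a, b] (-x) = -posCycle [a, b] x := h.mem_groupD.1.1
  by_cases h0 : posCycle [a, b] p.1 = -p.2
  · simp only [reflRoot, h0, if_true]
  · have h1 : ¬ p.1 = -posCycle [a, b] p.2 := by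
      rw [← hneg]
      exact fun h => h0 (by rw [h, hs])
    simp only [reflRoot, h0, if_false, hs, h1]

theorem reflRoot_inverted {n : ℕ} {a b : ℤ} (h : IsSimpleRoot n a b) {w : Equiv.Perm ℤ}
    (hw : w ∈ groupB n) (p : ℤ × ℤ) :
    w (reflRoot a b p).2 < w (reflRoot a b p).1 ↔
      (w * posCycle [a, b]) p.2 < (w * posCycle [a, b]) p.1 := by
  rw [Equiv.Perm.mul_apply, Equiv.Perm.mul_apply]
  by_cases h0 : posCycle [a, b] p.1 = -p.2
  · have h1 : posCycle [a, b] p.2 = -p.1 := by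
      have := congrArg (posCycle [a, b]) h0
      rw [← Equiv.Perm.mul_apply, h.mul_self, Equiv.Perm.one_apply, h.mem_groupD.1.1] at this
      lia
    simp only [reflRoot, h0, h1, if_true, hw.1]
    lia
  · simp only [reflRoot, h0, if_false]

theorem card_inverted_erase_mul {n : ℕ} {a b : ℤ} (h : IsSimpleRoot n a b) {w : Equiv.Perm ℤ}
    (hw : w ∈ groupB n) :
    (((posRoots n).erase (a, b)).filter fun p =>
      (w * posCycle [a, b]) p.2 < (w * posCycle [a, b]) p.1).card =
    (((posRoots n).erase (a, b)).filter fun p => w p.2 < w p.1).card := by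
  refine Finset.card_nbij' (reflRoot a b) (reflRoot a b) ?_ ?_ (fun p _ => reflRoot_reflRoot h p)
    (fun p _ => reflRoot_reflRoot h p)
  · intro p hp
    simp only [Finset.coe_filter, Set.mem_ofPred_eq] at hp ⊢
    exact ⟨reflRoot_mem h hp.1, (reflRoot_inverted h hw p).2 hp.2⟩
  · intro p hp
    simp only [Finset.coe_filter, Set.mem_ofPred_eq] at hp ⊢
    refine ⟨reflRoot_mem h hp.1, (reflRoot_inverted h hw _).1 ?_⟩
    rw [reflRoot_reflRoot h]
    exact hp.2

/-- A simple reflection permutes the positive roots other than its own, so right multiplication by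
it changes only whether that one root is inverted. -/
theorem invCount_mul {n : ℕ} {a b : ℤ} (h : IsSimpleRoot n a b) {w : Equiv.Perm ℤ}
    (hw : w ∈ groupB n) :
    (w a < w b ∧ invCount n (w * posCycle [a, b]) = invCount n w + 1) ∨
    (w b < w a ∧ invCount n (w * posCycle [a, b]) + 1 = invCount n w) := by
  have hne : a ≠ b := by
    unfold IsSimpleRoot at h
    lia
  have ha : (w * posCycle [a, b]) a = w b := by
    rw [Equiv.Perm.mul_apply, h.apply, if_pos rfl]
  have hb : (w * posCycle [a, b]) b = w a := by
    rw [Equiv.Perm.mul_apply, h.apply, if_neg hne.symm, if_pos rfl]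
  have hw' : w a ≠ w b := fun e => hne (w.injective e)
  rw [invCount_eq_erase w h, invCount_eq_erase (w * posCycle [a, b]) h,
    card_inverted_erase_mul h hw, ha, hb]
  split_ifs <;> lia

/-- Without descents, `w` is increasing on `1, …, n` and `|w 1| < w 2`. Hence `w 2 ≥ 2`, and
climbing gives `w x ≥ x` for `x ≥ 2`; descending from `w n ≤ n` gives the reverse inequality. What
remains is `w 1 = ±1`, and the parity condition excludes `-1`. -/
theorem eq_one_of_no_descent {n : ℕ} {w : Equiv.Perm ℤ} (hn : 2 ≤ n) (hw : w ∈ groupD n)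
    (H : ∀ a b, IsSimpleRoot n a b → w a < w b) : w = 1 := by
  have hB := hw.1
  have hstep : ∀ x : ℤ, 1 ≤ x → x + 1 ≤ n → w x < w (x + 1) := fun x h1 h2 =>
    H x (x + 1) (Or.inr ⟨h1, rfl, h2⟩)
  have h12 := hstep 1 le_rfl (by lia)
  have h12' := H (-1) 2 (Or.inl ⟨rfl, rfl, by lia⟩)
  have h1 := apply_ne_zero hB (i := 1) (by lia)
  rw [hB.1] at h12'
  have hlow : ∀ t : ℕ, (t : ℤ) + 2 ≤ n → (t : ℤ) + 2 ≤ w (t + 2) := by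
    intro t
    induction t with
    | zero => intro _; norm_num at h12 ⊢; lia
    | succ t ih =>
      intro ht
      have e1 := ih (by push_cast at ht; lia)
      have e2 := hstep (t + 2) (by lia) (by push_cast at ht; lia)
      push_cast
      rw [show (t : ℤ) + 1 + 2 = t + 2 + 1 by ring]
      lia
  have hup : ∀ t : ℕ, (t : ℤ) + 2 ≤ n → w (n - t) ≤ n - t := by
    intro t
    induction t with
    | zero =>
      intro _
      have := abs_apply_mem hB (i := n) (by rw [Finset.mem_Icc]; lia)
      rw [Finset.mem_Icc] at this
      have h3 := le_abs_self (w n)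
      norm_num
      lia
    | succ t ih =>
      intro ht
      push_cast at ht
      have e1 := ih (by lia)
      have e2 := hstep (n - t - 1) (by lia) (by lia)
      push_cast
      rw [sub_add_cancel] at e2
      rw [show (n : ℤ) - (t + 1) = n - t - 1 by ring]
      lia
  have hfix : ∀ x : ℤ, 2 ≤ x → x ≤ n → w x = x := by
    intro x h2 hx
    have e1 := hlow (x - 2).toNat (by lia)
    have e2 := hup (n - x).toNat (by lia)
    rw [show ((x - 2).toNat : ℤ) + 2 = x by lia] at e1
    rw [show (n : ℤ) - ((n - x).toNat : ℤ) = x by lia] at e2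
    lia
  have h2 := hfix 2 le_rfl (by lia)
  have hw1 : w 1 = 1 := by
    by_contra hne
    have : negatives n w = {1} := by
      ext x
      simp only [negatives, Finset.mem_filter, Finset.mem_Icc, Finset.mem_singleton]
      constructor
      · rintro ⟨⟨hx1, hx2⟩, hx⟩
        by_contra hx'
        rw [hfix x (by lia) hx2] at hx
        lia
      · rintro rfl
        norm_num at h12
        lia
    have h3 := hw.2
    rw [this] at h3
    exact absurd h3 (by decide)
  refine groupB_ext hB (one_mem _) fun x hx hxn => ?_
  rw [Equiv.Perm.one_apply]
  rcases hx.eq_or_lt with rfl | hx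
  · exact hw1
  · exact hfix x hx hxn

/-! ### Descent-closed subgroups and reduced words -/

/-- `P` contains the simple reflections at all descents of its elements. -/
def DescentClosed (n : ℕ) (P : Subgroup (Equiv.Perm ℤ)) : Prop :=
  P ≤ groupD n ∧ ∀ g ∈ P, ∀ a b, IsSimpleRoot n a b → g b < g a → posCycle [a, b] ∈ P

/-- Stripping one descent at a time stays inside `P` and lowers the number of inversions by one,
until no descent is left. -/
theorem DescentClosed.exists_word {n : ℕ} (hn : 2 ≤ n) {P : Subgroup (Equiv.Perm ℤ)}
    (hP : DescentClosed n P) {g : Equiv.Perm ℤ} (hg : g ∈ P) :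
    ∃ l : List (Equiv.Perm ℤ), (∀ s ∈ l, s ∈ gensD n ∧ s ∈ P) ∧ l.prod = g ∧
      l.length = invCount n g := by
  induction hN : invCount n g using Nat.strong_induction_on generalizing g with
  | _ N ih =>
    by_cases H : ∀ a b, IsSimpleRoot n a b → g a < g b
    · have := eq_one_of_no_descent hn (hP.1 hg) H
      subst this
      refine ⟨[], by simp, rfl, ?_⟩
      rw [← hN, invCount, Finset.filter_false_of_mem]
      · rfl
      · intro p hp
        rw [mem_posRoots] at hp
        simp only [Equiv.Perm.one_apply]
        lia
    · push Not at H
      obtain ⟨a, b, hab, hle⟩ := H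
      rcases invCount_mul hab (hP.1 hg).1 with h | ⟨hlt, hc⟩
      · lia
      · have hs := hP.2 g hg a b hab hlt
        obtain ⟨l, hl, hprod, hlen⟩ := ih _ (by lia) (mul_mem hg hs) rfl
        refine ⟨l ++ [posCycle [a, b]], ?_, ?_, ?_⟩
        · intro s hs'
          rw [List.mem_append, List.mem_singleton] at hs'
          rcases hs' with hs' | rfl
          · exact hl s hs'
          · exact ⟨(mem_gensD_iff hn).2 ⟨a, b, hab, rfl⟩, hs⟩
        · rw [List.prod_append, hprod, List.prod_singleton, mul_assoc, hab.mul_self, mul_one]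
        · rw [List.length_append, hlen, List.length_singleton]
          lia

theorem prod_mem_groupD {n : ℕ} (hn : 2 ≤ n) {l : List (Equiv.Perm ℤ)}
    (hl : ∀ g ∈ l, g ∈ gensD n) : l.prod ∈ groupD n := by
  refine Subgroup.list_prod_mem _ fun g hg => ?_
  obtain ⟨a, b, hab, rfl⟩ := (mem_gensD_iff hn).1 (hl g hg)
  exact hab.mem_groupD

theorem invCount_prod_le {n : ℕ} (hn : 2 ≤ n) {l : List (Equiv.Perm ℤ)}
    (hl : ∀ g ∈ l, g ∈ gensD n) : invCount n l.prod ≤ l.length := by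
  induction l using List.reverseRecOn with
  | nil =>
    rw [List.prod_nil, invCount, Finset.filter_false_of_mem]
    · rfl
    · intro p hp
      rw [mem_posRoots] at hp
      simp only [Equiv.Perm.one_apply]
      lia
  | append_singleton l s ih =>
    have hl' : ∀ g ∈ l, g ∈ gensD n := fun g hg => hl g (by simp [hg])
    obtain ⟨a, b, hab, rfl⟩ := (mem_gensD_iff hn).1 (hl s (by simp))
    have h1 := ih hl'
    have h2 := invCount_mul hab (prod_mem_groupD hn hl').1
    rw [List.prod_append, List.prod_singleton, List.length_append, List.length_singleton]
    lia

/-- The last letter of a word of minimal length is a descent of its product, hence lies in `P`; the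
remaining word is again minimal with product in `P`. -/
theorem DescentClosed.mem_of_mem_word {n : ℕ} (hn : 2 ≤ n) {P : Subgroup (Equiv.Perm ℤ)}
    (hP : DescentClosed n P) {l : List (Equiv.Perm ℤ)} (hl : ∀ g ∈ l, g ∈ gensD n)
    (hlen : l.length ≤ invCount n l.prod) (hprod : l.prod ∈ P) : ∀ s ∈ l, s ∈ P := by
  induction l using List.reverseRecOn with
  | nil => simp
  | append_singleton l s ih =>
    have hl' : ∀ g ∈ l, g ∈ gensD n := fun g hg => hl g (by simp [hg])
    obtain ⟨a, b, hab, rfl⟩ := (mem_gensD_iff hn).1 (hl s (by simp))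
    have h1 := invCount_prod_le hn hl'
    have h2 := invCount_mul hab (prod_mem_groupD hn hl).1
    rw [List.prod_append, List.prod_singleton] at hlen hprod h2
    rw [mul_assoc, hab.mul_self, mul_one] at h2
    rw [List.length_append, List.length_singleton] at hlen
    have hs : posCycle [a, b] ∈ P := hP.2 _ hprod a b hab (by lia)
    have hlP : l.prod ∈ P := by
      have := mul_mem hprod hs
      rwa [mul_assoc, hab.mul_self, mul_one] at this
    intro t ht
    rw [List.mem_append, List.mem_singleton] at ht
    rcases ht with ht | rfl
    · exact ih hl' (by lia) hlP t ht
    · exact hs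

/-- The support is a union over all reduced words, so both inclusions need an argument: no reduced
word of `w` leaves `P`, and by `H` a single reduced word already uses every simple reflection of
`P`. -/
theorem DescentClosed.parabolicD_eq {n : ℕ} (hn : 2 ≤ n) {P : Subgroup (Equiv.Perm ℤ)}
    (hP : DescentClosed n P) {w : Equiv.Perm ℤ} (hw : w ∈ P)
    (H : ∀ s ∈ gensD n, s ∈ P → ∀ L ⊆ gensD n, w ∈ Subgroup.closure L → s ∈ L) :
    parabolicD n w = P := by
  obtain ⟨l, hl, hprod, hlen⟩ := hP.exists_word hn hw
  have hred : IsReducedExprD n w l := by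
    refine ⟨fun g hg => (hl g hg).1, hprod, fun l' hl' hp => ?_⟩
    rw [hlen, ← hp]
    exact invCount_prod_le hn hl'
  apply le_antisymm
  · rw [parabolicD, Subgroup.closure_le]
    rintro s ⟨l', ⟨hl', hp', hmin⟩, hs⟩
    refine hP.mem_of_mem_word hn hl' ?_ (hp' ▸ hw) s hs
    rw [hp', ← hlen]
    exact hmin l (fun g hg => (hl g hg).1) hprod
  · intro g hg
    obtain ⟨lg, hlg, rfl, -⟩ := hP.exists_word hn hg
    refine Subgroup.list_prod_mem _ fun s hs => Subgroup.subset_closure ⟨l, hred, ?_⟩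
    refine H s (hlg s hs).1 (hlg s hs).2 {t | t ∈ l} (fun t ht => (hl t ht).1) ?_
    rw [← hprod]
    exact Subgroup.list_prod_mem _ fun t ht => Subgroup.subset_closure ht

/-! ### Stabilisers of half-lines as parabolic subgroups -/

/-- The permutations that stabilise the set `A`. -/
def setStab (A : Set ℤ) : Subgroup (Equiv.Perm ℤ) where
  carrier := {g | ∀ x, g x ∈ A ↔ x ∈ A}
  one_mem' := fun _ => Iff.rfl
  mul_mem' := by
    intro g h hg hh x
    rw [Equiv.Perm.mul_apply, hg, hh]
  inv_mem' := by
    intro g hg x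
    rw [← hg, ← Equiv.Perm.mul_apply, mul_inv_cancel, Equiv.Perm.one_apply]

theorem mem_setStab {A : Set ℤ} {g : Equiv.Perm ℤ} : g ∈ setStab A ↔ ∀ x, g x ∈ A ↔ x ∈ A :=
  Iff.rfl

/-- The elements of `W(D_n)` that stabilise the set of all integers `> c`, for all `c ∈ C`. -/
noncomputable def cutStab (n : ℕ) (C : Set ℕ) : Subgroup (Equiv.Perm ℤ) :=
  groupD n ⊓ ⨅ c ∈ C, setStab (Set.Ioi (c : ℤ))

theorem mem_cutStab {n : ℕ} {C : Set ℕ} {g : Equiv.Perm ℤ} :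
    g ∈ cutStab n C ↔ g ∈ groupD n ∧ ∀ c ∈ C, ∀ x : ℤ, (c : ℤ) < g x ↔ (c : ℤ) < x := by
  simp only [cutStab, Subgroup.mem_inf, Subgroup.mem_iInf, mem_setStab, Set.mem_Ioi]

theorem cutStab_mem_iff {n : ℕ} {C : Set ℕ} {a b : ℤ} (h : IsSimpleRoot n a b) :
    posCycle [a, b] ∈ cutStab n C ↔ ∀ c ∈ C, ¬ (a ≤ c ∧ (c : ℤ) < b) := by
  rw [mem_cutStab, and_iff_right h.mem_groupD]
  constructor
  · rintro H c hc ⟨h1, h2⟩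
    have := H c hc a
    rw [h.apply, if_pos rfl] at this
    lia
  · intro H c hc x
    have := H c hc
    rw [h.apply]
    unfold IsSimpleRoot at h
    split_ifs <;> lia

theorem descentClosed_cutStab (n : ℕ) (C : Set ℕ) : DescentClosed n (cutStab n C) := by
  refine ⟨inf_le_left, fun g hg a b h hlt => ?_⟩
  rw [cutStab_mem_iff h]
  rintro c hc ⟨h1, h2⟩
  have e1 := (mem_cutStab.1 hg).2 c hc a
  have e2 := (mem_cutStab.1 hg).2 c hc b
  lia

/-- Each simple reflection is detected by a set that all the other simple reflections stabilise: if
it were missing from `L`, then `w` would stabilise that set. -/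
theorem parabolicD_eq_cutStab {n : ℕ} (hn : 2 ≤ n) {C : Set ℕ} {w : Equiv.Perm ℤ}
    (hw : w ∈ cutStab n C) (h1 : ∀ i : ℕ, i < n → i ∉ C → w ∉ setStab (Set.Ioi (i : ℤ)))
    (h2 : 1 ∉ C → w ∉ setStab {x : ℤ | x = -1 ∨ 2 ≤ x}) : parabolicD n w = cutStab n C := by
  refine (descentClosed_cutStab n C).parabolicD_eq hn hw fun s hs hsP L hL hwL => ?_
  by_contra hsL
  have key : ∀ A : Set ℤ, w ∉ setStab A → ∃ t ∈ L, t ∉ setStab A := by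
    intro A hA
    by_contra! hcon
    exact hA ((Subgroup.closure_le _).2 hcon hwL)
  obtain ⟨a, b, hab, rfl⟩ := (mem_gensD_iff hn).1 hs
  rw [cutStab_mem_iff hab] at hsP
  rcases id hab with ⟨rfl, rfl, hb⟩ | ⟨ha, rfl, hb⟩
  -- The set for `u` is `{x > 0}`, which every `s_i` preserves.
  · obtain ⟨t, htL, ht⟩ := key _ (h1 0 (by lia) fun h0 => hsP 0 h0 (by norm_num))
    obtain ⟨a', b', hab', rfl⟩ := (mem_gensD_iff hn).1 (hL htL)
    have hne : a' ≠ -1 := by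
      rintro rfl
      rcases hab' with ⟨-, rfl, -⟩ | h
      · exact hsL htL
      · lia
    refine ht fun x => ?_
    rw [Set.mem_Ioi, Set.mem_Ioi, hab'.apply]
    unfold IsSimpleRoot at hab'
    split_ifs <;> lia
  -- For `s_a` with `a ≥ 2` the half-line `{x > a}` works. For `a = 1` it does not, since `u` moves
  -- `2` to `-1`; its substitute is the image of `{x > 0}` under the sign change at `1`, the
  -- symmetry exchanging `u` and `s_1`.
  · have ht : ∃ t ∈ L, t ∉ setStab (if a = 1 then {x : ℤ | x = -1 ∨ 2 ≤ x} else Set.Ioi a) := by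
      apply key
      split_ifs with h
      · exact h2 fun hc => hsP 1 hc (by lia)
      · lift a to ℕ using by lia
        exact h1 a (by lia) fun hc => hsP a hc (by lia)
    obtain ⟨t, htL, ht⟩ := ht
    obtain ⟨a', b', hab', rfl⟩ := (mem_gensD_iff hn).1 (hL htL)
    have hne : a' ≠ a := by
      rintro rfl
      rcases hab' with h | ⟨-, rfl, -⟩
      · lia
      · exact hsL htL
    refine ht fun x => ?_
    rw [hab'.apply]
    unfold IsSimpleRoot at hab'
    split_ifs <;> simp only [Set.mem_Ioi, Set.mem_ofPred_eq] <;> lia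

theorem mem_setStab_of_finite {A : Set ℤ} (hA : A.Finite) {g : Equiv.Perm ℤ}
    (h : ∀ x ∈ A, g x ∈ A) : g ∈ setStab A := by
  have himg : g '' A = A := Set.eq_of_subset_of_ncard_le (Set.image_subset_iff.2 h)
    (Set.ncard_image_of_injective A g.injective).ge hA
  refine fun x => ⟨fun hx => ?_, h x⟩
  rw [← himg] at hx
  obtain ⟨y, hy, hyx⟩ := hx
  rwa [← g.injective hyx]

/-- One inclusion suffices, because beyond `n` everything is fixed and the rest of the half-line is
finite. -/
theorem mem_setStab_Ioi {n : ℕ} {g : Equiv.Perm ℤ} (hg : g ∈ groupB n) {c : ℕ}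
    (h : ∀ x : ℤ, (c : ℤ) < x → (c : ℤ) < g x) : g ∈ setStab (Set.Ioi (c : ℤ)) := by
  have hle : ∀ x : ℤ, x ≤ n → g x ≤ n := by
    intro x hx
    by_contra hlt
    have := g.injective (hg.2 (g x) (by rw [abs_of_pos (by lia)]; lia))
    lia
  have hfin : g ∈ setStab (Set.Ioc (c : ℤ) n) := by
    refine mem_setStab_of_finite (Set.finite_Ioc _ _) fun x hx => ?_
    rw [Set.mem_Ioc] at hx ⊢
    exact ⟨h x hx.1, hle x hx.2⟩
  refine fun x => ⟨fun hx => ?_, h x⟩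
  rw [Set.mem_Ioi] at hx ⊢
  by_contra hlt
  have h1 := hfin x
  rw [Set.mem_Ioc, Set.mem_Ioc] at h1
  by_cases hn : x ≤ n
  · have := hle x hn
    lia
  · have := hg.2 x (by rw [abs_of_pos (by lia)]; lia)
    lia

/-! ### Signed permutations supported on annuli, and cycles on blocks -/

theorem groupB_mono {p n : ℕ} (h : p ≤ n) : groupB p ≤ groupB n := fun _ hg =>
  ⟨hg.1, fun x hx => hg.2 x (by lia)⟩

theorem groupB_abs_le_iff {p : ℕ} {g : Equiv.Perm ℤ} (hg : g ∈ groupB p) (x : ℤ) :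
    |g x| ≤ p ↔ |x| ≤ p := by
  rw [← not_lt, ← not_lt, not_iff_not]
  constructor
  · intro h
    have := g.injective (hg.2 _ h)
    rwa [this] at h
  · intro h
    rwa [hg.2 _ h]

/-- The signed permutations moving only integers `x` with `o < |x| ≤ p`. -/
noncomputable def annulus (o p : ℕ) : Subgroup (Equiv.Perm ℤ) where
  carrier := {g | g ∈ groupB p ∧ ∀ x : ℤ, |x| ≤ o → g x = x}
  one_mem' := ⟨one_mem _, fun _ _ => rfl⟩
  mul_mem' := by
    rintro g h ⟨hg, hg'⟩ ⟨hh, hh'⟩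
    refine ⟨mul_mem hg hh, fun x hx => ?_⟩
    rw [Equiv.Perm.mul_apply, hh' x hx, hg' x hx]
  inv_mem' := by
    rintro g ⟨hg, hg'⟩
    refine ⟨inv_mem hg, fun x hx => ?_⟩
    rw [Equiv.Perm.inv_eq_iff_eq, hg' x hx]

theorem annulus_mono {o p o' p' : ℕ} (ho : o' ≤ o) (hp : p ≤ p') : annulus o p ≤ annulus o' p' :=
  fun _ hg => ⟨groupB_mono hp hg.1, fun x hx => hg.2 x (by lia)⟩

theorem annulus_le_iff {o p : ℕ} {g : Equiv.Perm ℤ} (hg : g ∈ annulus o p) (x : ℤ) :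
    |g x| ≤ o ↔ |x| ≤ o := by
  constructor
  · intro h
    have := g.injective (hg.2 _ h)
    rwa [this] at h
  · intro h
    rwa [hg.2 _ h]

theorem block_eq_map (o m : ℕ) :
    block o m = (List.range m).map fun i : ℕ => (o : ℤ) + 1 + i := by
  simp [block, List.map_eq_flatMap, List.flatMap_assoc]

theorem mem_block {o m : ℕ} {x : ℤ} : x ∈ block o m ↔ (o : ℤ) < x ∧ x ≤ o + m := by
  simp only [block_eq_map, List.mem_map, List.mem_range]
  constructor
  · rintro ⟨i, hi, rfl⟩
    lia
  · intro h
    exact ⟨(x - o - 1).toNat, by lia, by lia⟩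

theorem length_block (o m : ℕ) : (block o m).length = m := by
  simp [block_eq_map]

theorem getElem_block {o m i : ℕ} (h : i < (block o m).length) :
    (block o m)[i] = (o : ℤ) + 1 + i := by
  simp [block_eq_map]

theorem nodup_block (o m : ℕ) : (block o m).Nodup := by
  rw [block_eq_map]
  refine List.Nodup.map ?_ List.nodup_range
  intro a b h
  simpa using h

theorem exists_offset {o m : ℕ} {x : ℤ} (h1 : (o : ℤ) < x) (h2 : x ≤ o + m) :
    ∃ i < m, x = (o : ℤ) + 1 + (i : ℕ) :=
  ⟨(x - o - 1).toNat, by lia, by lia⟩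

theorem mem_neg_block {o m : ℕ} {x : ℤ} : x ∈ (block o m).map (fun i => -i) ↔ -x ∈ block o m := by
  simp only [List.mem_map]
  constructor
  · rintro ⟨y, hy, rfl⟩
    rwa [neg_neg]
  · intro h
    exact ⟨-x, h, neg_neg x⟩

theorem nodup_neg_block (o m : ℕ) : ((block o m).map (fun i => -i)).Nodup :=
  List.Nodup.map neg_injective (nodup_block o m)

theorem posCycle_block_apply {o m i : ℕ} (hi : i < m) :
    posCycle (block o m) ((o : ℤ) + 1 + i) = (o : ℤ) + 1 + ((i + 1) % m : ℕ) := by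
  rw [posCycle, Equiv.Perm.mul_apply,
    List.formPerm_apply_of_notMem (l := (block o m).map fun i => -i)]
  · have hl : i < (block o m).length := by rwa [length_block]
    have := List.formPerm_apply_getElem (block o m) (nodup_block o m) i hl
    rw [getElem_block, getElem_block, length_block] at this
    exact this
  · rw [mem_neg_block, mem_block]
    lia

theorem posCycle_block_apply_neg {o m i : ℕ} (hi : i < m) :
    posCycle (block o m) (-((o : ℤ) + 1 + i)) = -((o : ℤ) + 1 + ((i + 1) % m : ℕ)) := by
  have hl : i < ((block o m).map (fun i => -i)).length := by rwa [List.length_map, length_block]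
  have h := List.formPerm_apply_getElem _ (nodup_neg_block o m) i hl
  rw [List.getElem_map, List.getElem_map, getElem_block, getElem_block, List.length_map,
    length_block] at h
  rw [posCycle, Equiv.Perm.mul_apply, h, List.formPerm_apply_of_notMem]
  rw [mem_block]
  lia

theorem posCycle_block_apply_of_notMem {o m : ℕ} {x : ℤ} (h : x ∉ block o m)
    (h' : -x ∉ block o m) : posCycle (block o m) x = x := by
  rw [posCycle, Equiv.Perm.mul_apply,
    List.formPerm_apply_of_notMem (l := (block o m).map fun i => -i) (by rwa [mem_neg_block]),
    List.formPerm_apply_of_notMem h]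

theorem posCycle_block_mem (o m : ℕ) : posCycle (block o m) ∈ annulus o (o + m) := by
  refine ⟨⟨fun x => ?_, fun x hx => ?_⟩, fun x hx => ?_⟩
  · by_cases h : x ∈ block o m
    · rw [mem_block] at h
      obtain ⟨i, hi, rfl⟩ := exists_offset h.1 h.2
      rw [posCycle_block_apply_neg hi, posCycle_block_apply hi]
    · by_cases h' : -x ∈ block o m
      · rw [mem_block] at h'
        obtain ⟨i, hi, hx⟩ := exists_offset h'.1 h'.2
        obtain rfl : x = -((o : ℤ) + 1 + i) := by lia
        rw [neg_neg, posCycle_block_apply_neg hi, posCycle_block_apply hi, neg_neg]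
      · rw [posCycle_block_apply_of_notMem h h', posCycle_block_apply_of_notMem h']
        rwa [neg_neg]
  all_goals
    have := abs_cases x
    apply posCycle_block_apply_of_notMem <;> rw [mem_block] <;> lia

theorem posCycle_block_pow_apply {o m i : ℕ} (hi : i < m) (r : ℕ) :
    (posCycle (block o m) ^ r) ((o : ℤ) + 1 + i) = (o : ℤ) + 1 + ((i + r) % m : ℕ) := by
  induction r with
  | zero => rw [pow_zero, Equiv.Perm.one_apply, add_zero, Nat.mod_eq_of_lt hi]
  | succ r ih =>
    rw [pow_succ', Equiv.Perm.mul_apply, ih, posCycle_block_apply (Nat.mod_lt _ (by lia)),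
      Nat.mod_add_mod, add_assoc i r 1]

theorem nodup_signed_block (o m : ℕ) :
    (block o m ++ (block o m).map (fun i => -i)).Nodup := by
  rw [List.nodup_append]
  refine ⟨nodup_block o m, nodup_neg_block o m, fun a ha b hb => ?_⟩
  rw [mem_neg_block, mem_block] at hb
  rw [mem_block] at ha
  lia

theorem negCycle_block_apply_of_notMem {o m : ℕ} {x : ℤ} (h : x ∉ block o m)
    (h' : -x ∉ block o m) : negCycle (block o m) x = x := by
  refine List.formPerm_apply_of_notMem ?_
  rw [List.mem_append, mem_neg_block]
  tauto

theorem negCycle_block_apply {o m i : ℕ} (hi : i < m) :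
    negCycle (block o m) ((o : ℤ) + 1 + i) =
      if i + 1 < m then (o : ℤ) + 1 + ((i + 1 : ℕ) : ℤ) else -((o : ℤ) + 1) := by
  have hl : i < (block o m ++ (block o m).map (fun i => -i)).length := by
    simp only [List.length_append, List.length_map, length_block]
    lia
  have h := List.formPerm_apply_getElem _ (nodup_signed_block o m) i hl
  have hlen : (i + 1) % (block o m ++ (block o m).map (fun i => -i)).length = i + 1 := by
    simp only [List.length_append, List.length_map, length_block]
    exact Nat.mod_eq_of_lt (by lia)
  simp only [hlen] at h
  rw [List.getElem_append_left (by rwa [length_block]), getElem_block] at h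
  rw [negCycle, h]
  split_ifs with him
  · rw [List.getElem_append_left (by rwa [length_block]), getElem_block]
  · rw [List.getElem_append_right (by rw [length_block]; lia), List.getElem_map, getElem_block]
    simp only [length_block]
    lia

theorem negCycle_block_apply_neg {o m i : ℕ} (hi : i < m) :
    negCycle (block o m) (-((o : ℤ) + 1 + i)) =
      -if i + 1 < m then (o : ℤ) + 1 + ((i + 1 : ℕ) : ℤ) else -((o : ℤ) + 1) := by
  have hlen : (block o m ++ (block o m).map (fun i => -i)).length = m + m := by
    simp only [List.length_append, List.length_map, length_block]
  have hl : m + i < (block o m ++ (block o m).map (fun i => -i)).length := by lia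
  have h := List.formPerm_apply_getElem _ (nodup_signed_block o m) (m + i) hl
  rw [List.getElem_append_right (by rw [length_block]; lia), List.getElem_map, getElem_block] at h
  simp only [length_block, add_tsub_cancel_left] at h
  rw [negCycle, h]
  split_ifs with him
  · have e : (m + i + 1) % (block o m ++ (block o m).map (fun i => -i)).length = m + (i + 1) := by
      rw [hlen]
      exact Nat.mod_eq_of_lt (by lia)
    simp only [e]
    rw [List.getElem_append_right (by rw [length_block]; lia), List.getElem_map, getElem_block]
    simp only [length_block, add_tsub_cancel_left]
  · have e : (m + i + 1) % (block o m ++ (block o m).map (fun i => -i)).length = 0 := by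
      rw [hlen, show m + i + 1 = m + m by lia, Nat.mod_self]
    simp only [e]
    rw [List.getElem_append_left (by rw [length_block]; lia), getElem_block]
    simp

theorem negCycle_block_mem (o m : ℕ) : negCycle (block o m) ∈ annulus o (o + m) := by
  refine ⟨⟨fun x => ?_, fun x hx => ?_⟩, fun x hx => ?_⟩
  · by_cases h : x ∈ block o m
    · rw [mem_block] at h
      obtain ⟨i, hi, rfl⟩ := exists_offset h.1 h.2
      rw [negCycle_block_apply_neg hi, negCycle_block_apply hi]
    · by_cases h' : -x ∈ block o m
      · rw [mem_block] at h'
        obtain ⟨i, hi, hx⟩ := exists_offset h'.1 h'.2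
        obtain rfl : x = -((o : ℤ) + 1 + i) := by lia
        rw [neg_neg, negCycle_block_apply_neg hi, negCycle_block_apply hi, neg_neg]
      · rw [negCycle_block_apply_of_notMem h h', negCycle_block_apply_of_notMem h']
        rwa [neg_neg]
  all_goals
    have := abs_cases x
    apply negCycle_block_apply_of_notMem <;> rw [mem_block] <;> lia

theorem negCycle_block_pow_apply_first {o m i : ℕ} (hi : i < m) :
    (negCycle (block o m) ^ i) ((o : ℤ) + 1) = (o : ℤ) + 1 + i := by
  induction i with
  | zero => simp
  | succ i ih => rw [pow_succ', Equiv.Perm.mul_apply, ih (by lia), negCycle_block_apply (by lia),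
      if_pos hi]

/-- This separates negative from positive cycles: some power of a negative cycle negates all its
points. -/
theorem negCycle_block_pow_apply {o m i : ℕ} (hi : i < m) :
    (negCycle (block o m) ^ m) ((o : ℤ) + 1 + i) = -((o : ℤ) + 1 + i) := by
  have h1 : (negCycle (block o m) ^ m) ((o : ℤ) + 1) = -((o : ℤ) + 1) := by
    obtain ⟨m', rfl⟩ : ∃ m', m = m' + 1 := ⟨m - 1, by lia⟩
    rw [pow_succ', Equiv.Perm.mul_apply, negCycle_block_pow_apply_first (by lia),
      negCycle_block_apply (by lia), if_neg (by lia)]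
  rw [← negCycle_block_pow_apply_first hi, ← Equiv.Perm.mul_apply, ← pow_add, add_comm m i,
    pow_add, Equiv.Perm.mul_apply, h1, (pow_mem (negCycle_block_mem o m) i).1.1]

/-! ### Products of cycles on consecutive blocks -/

theorem cycleProd_mem {c : List ℤ → Equiv.Perm ℤ}
    (hc : ∀ o m, c (block o m) ∈ annulus o (o + m)) (o : ℕ) (l : List ℕ) :
    cycleProd c o l ∈ annulus o (o + l.sum) := by
  induction l generalizing o with
  | nil => exact one_mem _
  | cons m l ih =>
    rw [cycleProd, List.sum_cons]
    exact mul_mem (annulus_mono le_rfl (by lia) (hc o m))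
      (annulus_mono (by lia) (by lia) (ih (o + m)))

theorem cycleProd_append (c : List ℤ → Equiv.Perm ℤ) (o : ℕ) (l l' : List ℕ) :
    cycleProd c o (l ++ l') = cycleProd c o l * cycleProd c (o + l.sum) l' := by
  induction l generalizing o with
  | nil => simp [cycleProd]
  | cons m l ih =>
    rw [List.cons_append, cycleProd, cycleProd, ih, List.sum_cons, mul_assoc, add_assoc]

theorem mul_apply_of_annulus {p q : ℕ} {g h : Equiv.Perm ℤ}
    (hh : h ∈ annulus p q) {x : ℤ} (hx : |x| ≤ p) : (g * h) x = g x := by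
  rw [Equiv.Perm.mul_apply, hh.2 x hx]

theorem mul_apply_of_annulus' {o p q : ℕ} {g h : Equiv.Perm ℤ} (hg : g ∈ annulus o p)
    (hh : h ∈ annulus p q) {x : ℤ} (hx : p < |x|) : (g * h) x = h x := by
  rw [Equiv.Perm.mul_apply, hg.1.2]
  rwa [← not_le, annulus_le_iff hh, not_le]

theorem sum_take_succ (l : List ℕ) {j : ℕ} (hj : j < l.length) :
    (l.take (j + 1)).sum = (l.take j).sum + l[j] := by
  rw [List.take_add_one, List.sum_append, List.getElem?_eq_getElem hj]
  simp

theorem cycleProd_apply {c : List ℤ → Equiv.Perm ℤ}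
    (hc : ∀ o m, c (block o m) ∈ annulus o (o + m)) (o : ℕ) (l : List ℕ) {j : ℕ}
    (hj : j < l.length) {x : ℤ} (h1 : ((o + (l.take j).sum : ℕ) : ℤ) < |x|)
    (h2 : |x| ≤ ((o + (l.take (j + 1)).sum : ℕ) : ℤ)) :
    cycleProd c o l x = c (block (o + (l.take j).sum) l[j]) x := by
  rw [sum_take_succ l hj, ← add_assoc] at h2
  conv_lhs => rw [← List.take_append_drop j l, cycleProd_append]
  rw [mul_apply_of_annulus' (cycleProd_mem hc _ _) (cycleProd_mem hc _ _) h1,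
    List.drop_eq_getElem_cons hj, cycleProd, mul_apply_of_annulus (cycleProd_mem hc _ _) h2]

theorem exists_sum_take (l : List ℕ) {y : ℕ} (h1 : 0 < y) (h2 : y ≤ l.sum) :
    ∃ j, ∃ _ : j < l.length, (l.take j).sum < y ∧ y ≤ (l.take (j + 1)).sum := by
  induction l generalizing y with
  | nil => simp at h2; lia
  | cons m l ih =>
    by_cases hy : y ≤ m
    · exact ⟨0, by simp, by simpa using h1, by simpa using hy⟩
    · rw [List.sum_cons] at h2
      obtain ⟨j, hj, h3, h4⟩ := ih (y := y - m) (by lia) (by lia)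
      refine ⟨j + 1, by simpa using hj, ?_, ?_⟩
      · rw [List.take_succ_cons, List.sum_cons]
        lia
      · rw [List.take_succ_cons, List.sum_cons]
        lia

theorem sum_take_mono (l : List ℕ) {i j : ℕ} (h : i ≤ j) : (l.take i).sum ≤ (l.take j).sum := by
  rw [← Nat.add_sub_cancel' h, List.take_add, List.sum_append]
  lia

/-! ### The elements `t(o, m)` and `s(o, m)` -/

theorem blockNeg_succ (o m : ℕ) : blockNeg o (m + 1) =
    blockNeg o m * Equiv.swap ((o : ℤ) + 1 + m) (-((o : ℤ) + 1 + m)) := by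
  rw [blockNeg, blockNeg, block_eq_map, block_eq_map, List.range_succ, List.map_append,
    List.map_append, List.prod_append]
  rfl

theorem blockNeg_apply (o m : ℕ) (x : ℤ) :
    blockNeg o m x = if (o : ℤ) < |x| ∧ |x| ≤ o + m then -x else x := by
  induction m generalizing x with
  | zero =>
    rw [if_neg (by lia)]
    rfl
  | succ m ih =>
    have habs := abs_cases x
    rw [blockNeg_succ, Equiv.Perm.mul_apply]
    by_cases hx : |x| = o + 1 + m
    · have hs : Equiv.swap ((o : ℤ) + 1 + m) (-((o : ℤ) + 1 + m)) x = -x := by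
        rw [Equiv.swap_apply_def]
        split_ifs <;> lia
      rw [hs, ih, if_neg (by rw [abs_neg]; lia), if_pos (by push_cast; lia)]
    · rw [Equiv.swap_apply_of_ne_of_ne (by lia) (by lia), ih]
      push_cast
      congr 1
      simp only [eq_iff_iff]
      lia

theorem blockNeg_mem (o m : ℕ) : blockNeg o m ∈ annulus o (o + m) := by
  refine ⟨⟨fun x => ?_, fun x hx => ?_⟩, fun x hx => ?_⟩
  · rw [blockNeg_apply, blockNeg_apply, abs_neg]
    split_ifs <;> rfl
  all_goals
    rw [blockNeg_apply, if_neg (by lia)]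

theorem blockSwap_mem (o m : ℕ) : blockSwap o m ∈ annulus o (o + 2 * m) :=
  pow_mem (posCycle_block_mem o (2 * m)) m

theorem blockSwap_apply_left {o m : ℕ} {x : ℤ} (h1 : (o : ℤ) < x) (h2 : x ≤ o + m) :
    blockSwap o m x = x + m := by
  obtain ⟨i, hi, rfl⟩ := exists_offset h1 h2
  rw [blockSwap, posCycle_block_pow_apply (by lia), Nat.mod_eq_of_lt (by lia)]
  push_cast
  ring

theorem blockSwap_apply_right {o m : ℕ} {x : ℤ} (h1 : (o : ℤ) + m < x) (h2 : x ≤ o + 2 * m) :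
    blockSwap o m x = x - m := by
  obtain ⟨i, hi, rfl⟩ := exists_offset (o := o + m) (m := m) (x := x) (by lia) (by lia)
  have := posCycle_block_pow_apply (o := o) (m := 2 * m) (i := m + i) (by lia) m
  rw [show m + i + m = 2 * m + i by ring, Nat.add_mod_left, Nat.mod_eq_of_lt (by lia)] at this
  rw [blockSwap, show ((o + m : ℕ) : ℤ) + 1 + i = o + 1 + (m + i : ℕ) by push_cast; ring, this]
  push_cast
  ring

theorem blockSwap_apply_of_pos_le {o m : ℕ} {x : ℤ} (h1 : 0 ≤ x) (h2 : x ≤ o) :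
    blockSwap o m x = x :=
  (blockSwap_mem o m).2 x (by rwa [abs_of_nonneg h1])

theorem blockSwap_apply_of_lt {o m : ℕ} {x : ℤ} (h : (o : ℤ) + 2 * m < x) :
    blockSwap o m x = x :=
  (blockSwap_mem o m).1.2 x (by rw [abs_of_pos (by lia)]; push_cast; exact h)

/-! ### The sign character with kernel `W(D_n)` -/

/-- The product of the signs of `g 1, …, g n`. -/
noncomputable def signProd (n : ℕ) (g : Equiv.Perm ℤ) : ℤ :=
  ∏ i ∈ Finset.Icc 1 (n : ℤ), (g i).sign

theorem signProd_mul {n : ℕ} {v w : Equiv.Perm ℤ} (hv : v ∈ groupB n) (hw : w ∈ groupB n) :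
    signProd n (v * w) = signProd n v * signProd n w :=
  prod_sign_mul hv hw

theorem mem_groupD_iff {n : ℕ} {g : Equiv.Perm ℤ} (hg : g ∈ groupB n) :
    g ∈ groupD n ↔ signProd n g = 1 := by
  rw [signProd, prod_sign_eq hg, neg_one_pow_eq_one_iff_even (by norm_num)]
  exact ⟨fun h => h.2, fun h => ⟨hg, h⟩⟩

theorem signProd_of_pos {n : ℕ} {g : Equiv.Perm ℤ} (h : ∀ x : ℤ, 0 < x → 0 < g x) :
    signProd n g = 1 := by
  refine Finset.prod_eq_one fun x hx => ?_
  rw [Finset.mem_Icc] at hx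
  exact Int.sign_eq_one_of_pos (h x (by lia))

theorem posCycle_block_pos {o m : ℕ} {x : ℤ} (hx : 0 < x) : 0 < posCycle (block o m) x := by
  by_cases h : x ∈ block o m
  · rw [mem_block] at h
    obtain ⟨i, hi, rfl⟩ := exists_offset h.1 h.2
    rw [posCycle_block_apply hi]
    lia
  · rwa [posCycle_block_apply_of_notMem h (by rw [mem_block]; lia)]

theorem blockSwap_pos {o m : ℕ} {x : ℤ} (hx : 0 < x) : 0 < blockSwap o m x := by
  by_cases h1 : x ≤ o
  · rwa [blockSwap_apply_of_pos_le hx.le h1]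
  by_cases h2 : x ≤ o + m
  · rw [blockSwap_apply_left (by lia) h2]
    lia
  by_cases h3 : x ≤ o + 2 * m
  · rw [blockSwap_apply_right (by lia) h3]
    lia
  · rwa [blockSwap_apply_of_lt (by lia)]

theorem signProd_negCycle {n o m : ℕ} (hm : 0 < m) (h : o + m ≤ n) :
    signProd n (negCycle (block o m)) = -1 := by
  have hneg : negatives n (negCycle (block o m)) = {((o + m : ℕ) : ℤ)} := by
    ext x
    simp only [negatives, Finset.mem_filter, Finset.mem_Icc, Finset.mem_singleton]
    by_cases hx : x ∈ block o m
    · rw [mem_block] at hx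
      obtain ⟨i, hi, rfl⟩ := exists_offset hx.1 hx.2
      rw [negCycle_block_apply hi]
      split_ifs <;> lia
    · by_cases hx' : -x ∈ block o m
      · rw [mem_block] at hx'
        lia
      · rw [negCycle_block_apply_of_notMem hx hx']
        rw [mem_block] at hx
        lia
  rw [signProd, prod_sign_eq (groupB_mono h (negCycle_block_mem o m).1), hneg,
    Finset.card_singleton, pow_one]

theorem signProd_blockNeg {n o m : ℕ} (h : o + m ≤ n) : signProd n (blockNeg o m) = (-1) ^ m := by
  have hneg : negatives n (blockNeg o m) = Finset.Icc ((o : ℤ) + 1) (o + m) := by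
    ext x
    have := abs_cases x
    simp only [negatives, Finset.mem_filter, Finset.mem_Icc, blockNeg_apply]
    split_ifs <;> lia
  rw [signProd, prod_sign_eq (groupB_mono h (blockNeg_mem o m).1), hneg, Int.card_Icc]
  congr 1
  lia

theorem cycleProd_negCycle_mem (o : ℕ) (l : List ℕ) :
    cycleProd negCycle o l ∈ annulus o (o + l.sum) :=
  cycleProd_mem negCycle_block_mem o l

theorem cycleProd_posCycle_mem (o : ℕ) (l : List ℕ) :
    cycleProd posCycle o l ∈ annulus o (o + l.sum) :=
  cycleProd_mem posCycle_block_mem o l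

theorem signProd_cycleProd_negCycle {n : ℕ} (o : ℕ) (l : List ℕ) (hl : ∀ m ∈ l, 0 < m)
    (h : o + l.sum ≤ n) : signProd n (cycleProd negCycle o l) = (-1) ^ l.length := by
  induction l generalizing o with
  | nil => exact signProd_of_pos fun x hx => hx
  | cons m l ih =>
    rw [List.sum_cons] at h
    rw [cycleProd, signProd_mul (groupB_mono (by lia) (negCycle_block_mem o m).1)
      (groupB_mono (by lia) (cycleProd_negCycle_mem (o + m) l).1),
      signProd_negCycle (hl m (by simp)) (by lia),
      ih (o + m) (fun k hk => hl k (by simp [hk])) (by lia), List.length_cons, pow_succ']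

theorem cycleProd_posCycle_pos (o : ℕ) (l : List ℕ) {x : ℤ} (hx : 0 < x) :
    0 < cycleProd posCycle o l x := by
  induction l generalizing o with
  | nil => exact hx
  | cons m l ih =>
    rw [cycleProd, Equiv.Perm.mul_apply]
    exact posCycle_block_pos (ih _)

/-! ### Partial sums of sorted lists and multiplicities -/

theorem sum_mul_count_eq_zero {l : List ℕ} {m : ℕ} (h : ∀ b ∈ l, m ≤ b) :
    ∑ t ∈ Finset.range m, t * l.count t = 0 := by
  refine Finset.sum_eq_zero fun t ht => ?_
  rw [Finset.mem_range] at ht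
  rw [List.count_eq_zero.2, mul_zero]
  intro hmem
  have := h t hmem
  lia

theorem sum_mul_count_cons {l : List ℕ} {a m : ℕ} (h : a < m) :
    ∑ t ∈ Finset.range m, t * (a :: l).count t = a + ∑ t ∈ Finset.range m, t * l.count t := by
  simp only [List.count_cons, mul_add, Finset.sum_add_distrib]
  rw [add_comm]
  congr 1
  rw [Finset.sum_eq_single a]
  · simp
  · intro b _ hb
    simp [hb.symm]
  · simp [h]

/-- In a sorted list, the parts before position `j` are all the parts smaller than `l[j]` and some
copies of `l[j]` itself. With its converse below, this translates between the offsets `o_m + i m`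
and the starting points of the cycles. -/
theorem sum_take_eq_of_sorted {l : List ℕ} (hl : l.Pairwise (· ≤ ·)) {j : ℕ} (hj : j < l.length) :
    ∃ i < l.count l[j],
      (l.take j).sum = ∑ t ∈ Finset.range l[j], t * l.count t + i * l[j] := by
  induction l generalizing j with
  | nil => simp at hj
  | cons a l ih =>
    rw [List.pairwise_cons] at hl
    cases j with
    | zero =>
      refine ⟨0, by simp, ?_⟩
      rw [List.getElem_cons_zero, sum_mul_count_eq_zero]
      · simp
      · intro b hb
        rw [List.mem_cons] at hb
        rcases hb with rfl | hb
        · exact le_rfl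
        · exact hl.1 b hb
    | succ j =>
      simp only [List.length_cons, add_lt_add_iff_right] at hj
      obtain ⟨i, hi, hs⟩ := ih hl.2 hj
      simp only [List.getElem_cons_succ, List.take_succ_cons, List.sum_cons]
      rcases (hl.1 _ (List.getElem_mem hj)).lt_or_eq with h | h
      · refine ⟨i, ?_, ?_⟩
        · rw [List.count_cons]
          lia
        · rw [sum_mul_count_cons h, hs]
          ring
      · refine ⟨i + 1, ?_, ?_⟩
        · rw [List.count_cons]
          simp only [h, beq_self_eq_true, if_true]
          lia
        · rw [sum_mul_count_eq_zero] at hs ⊢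
          · rw [hs, ← h]
            ring
          · intro b hb
            rw [← h]
            rw [List.mem_cons] at hb
            rcases hb with rfl | hb
            · exact le_rfl
            · exact hl.1 b hb
          · intro b hb
            rw [← h]
            exact hl.1 b hb

theorem exists_sum_take_of_sorted {l : List ℕ} (hl : l.Pairwise (· ≤ ·)) {m i : ℕ}
    (hi : i < l.count m) : ∃ j, ∃ hj : j < l.length, l[j] = m ∧
      (l.take j).sum = ∑ t ∈ Finset.range m, t * l.count t + i * m := by
  induction l generalizing i with
  | nil => simp at hi
  | cons a l ih =>
    rw [List.pairwise_cons] at hl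
    have hz : ∀ h : a = m, (∑ t ∈ Finset.range m, t * (a :: l).count t = 0) ∧
        ∑ t ∈ Finset.range m, t * l.count t = 0 := by
      rintro rfl
      refine ⟨sum_mul_count_eq_zero fun b hb => ?_, sum_mul_count_eq_zero hl.1⟩
      rw [List.mem_cons] at hb
      rcases hb with rfl | hb
      · exact le_rfl
      · exact hl.1 b hb
    rcases lt_trichotomy a m with h | h | h
    · rw [List.count_cons_of_ne h.ne] at hi
      obtain ⟨j, hj, h1, h2⟩ := ih hl.2 hi
      refine ⟨j + 1, by simpa using hj, by simpa using h1, ?_⟩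
      rw [List.take_succ_cons, List.sum_cons, h2, sum_mul_count_cons h]
      ring
    · cases i with
      | zero => exact ⟨0, by simp, by simpa using h, by simp [(hz h).1]⟩
      | succ i =>
        rw [h, List.count_cons_self] at hi
        obtain ⟨j, hj, h1, h2⟩ := ih hl.2 (i := i) (by lia)
        refine ⟨j + 1, by simpa using hj, by simpa using h1, ?_⟩
        rw [List.take_succ_cons, List.sum_cons, h2, (hz h).1, (hz h).2, h]
        ring
    · have : m ∉ a :: l := by
        rw [List.mem_cons, not_or]
        exact ⟨h.ne, fun hm => by have := hl.1 m hm; lia⟩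
      rw [List.count_eq_zero.2 this] at hi
      lia

/-! ### The action of `w_λ` on its cycles -/

namespace DoublePartition

variable {n : ℕ} (lam : DoublePartition n)

/-- The last point before the positive cycle of index `j`. -/
def cut (j : ℕ) : ℕ := lam.neg.sum + (lam.pos.take j).sum

theorem cut_zero : lam.cut 0 = lam.neg.sum := by simp [cut]

theorem cut_length : lam.cut lam.pos.length = n := by
  rw [cut, List.take_length, add_comm, lam.sum_eq]

theorem cut_succ {j : ℕ} (hj : j < lam.pos.length) : lam.cut (j + 1) = lam.cut j + lam.pos[j] := by
  rw [cut, cut, sum_take_succ _ hj, add_assoc]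

theorem cut_mono {i j : ℕ} (h : i ≤ j) : lam.cut i ≤ lam.cut j :=
  Nat.add_le_add_left (sum_take_mono _ h) _

theorem cut_le (j : ℕ) : lam.cut j ≤ n := by
  rcases le_total j lam.pos.length with h | h
  · exact (lam.cut_mono h).trans lam.cut_length.le
  · rw [cut, List.take_of_length_le h, add_comm, lam.sum_eq]

theorem le_cut (j : ℕ) : lam.neg.sum ≤ lam.cut j := Nat.le_add_right _ _

theorem neg_sum_le : lam.neg.sum ≤ n := lam.cut_zero ▸ lam.cut_le 0

theorem part_pos {j : ℕ} (hj : j < lam.pos.length) : 0 < lam.pos[j] :=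
  lam.pos_parts _ (List.getElem_mem hj)

theorem exists_cut {x : ℤ} (h1 : (lam.neg.sum : ℤ) < x) (h2 : x ≤ n) :
    ∃ j, ∃ hj : j < lam.pos.length, ∃ i < lam.pos[j], x = (lam.cut j : ℤ) + 1 + (i : ℕ) := by
  have := lam.sum_eq
  obtain ⟨j, hj, h3, h4⟩ := exists_sum_take lam.pos (y := (x - lam.neg.sum).toNat) (by lia) (by lia)
  rw [sum_take_succ _ hj] at h4
  refine ⟨j, hj, (x - lam.cut j - 1).toNat, ?_, ?_⟩ <;> unfold cut <;> lia

theorem cut_index_unique {j j' : ℕ} {x : ℤ} (h1 : (lam.cut j : ℤ) < x) (h2 : x ≤ lam.cut (j + 1))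
    (h3 : (lam.cut j' : ℤ) < x) (h4 : x ≤ lam.cut (j' + 1)) : j = j' := by
  rcases lt_trichotomy j j' with h | h | h
  · have := lam.cut_mono (Nat.succ_le_of_lt h)
    lia
  · exact h
  · have := lam.cut_mono (Nat.succ_le_of_lt h)
    lia

theorem rep_pos_mem : cycleProd posCycle lam.neg.sum lam.pos ∈ annulus lam.neg.sum n := by
  have := cycleProd_posCycle_mem lam.neg.sum lam.pos
  rwa [add_comm, lam.sum_eq] at this

theorem rep_neg_mem : cycleProd negCycle 0 lam.neg ∈ annulus 0 lam.neg.sum := by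
  have := cycleProd_negCycle_mem 0 lam.neg
  rwa [zero_add] at this

theorem rep_mem_groupB : lam.rep ∈ groupB n :=
  mul_mem (groupB_mono lam.neg_sum_le lam.rep_neg_mem.1) lam.rep_pos_mem.1

theorem rep_mem_groupD (h : Even lam.neg.length) : lam.rep ∈ groupD n := by
  rw [mem_groupD_iff lam.rep_mem_groupB, rep,
    signProd_mul (groupB_mono lam.neg_sum_le lam.rep_neg_mem.1) lam.rep_pos_mem.1,
    signProd_cycleProd_negCycle 0 _ lam.neg_parts (by rw [zero_add]; exact lam.neg_sum_le),
    signProd_of_pos fun x hx => cycleProd_posCycle_pos _ _ hx, h.neg_one_pow, one_mul]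

theorem rep_apply_pos {j i : ℕ} (hj : j < lam.pos.length) (hi : i < lam.pos[j]) :
    lam.rep ((lam.cut j : ℤ) + 1 + i) = (lam.cut j : ℤ) + 1 + ((i + 1) % lam.pos[j] : ℕ) := by
  have h1 := lam.le_cut j
  have h2 := lam.cut_succ hj
  have e : |(lam.cut j : ℤ) + 1 + i| = (lam.cut j : ℤ) + 1 + i := abs_of_pos (by lia)
  rw [rep, mul_apply_of_annulus' lam.rep_neg_mem lam.rep_pos_mem (by rw [e]; lia),
    cycleProd_apply posCycle_block_mem lam.neg.sum lam.pos hj]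
  · exact posCycle_block_apply hi
  · change (lam.cut j : ℤ) < _
    lia
  · change _ ≤ (lam.cut (j + 1) : ℤ)
    lia

theorem rep_pow_apply_pos {j i : ℕ} (hj : j < lam.pos.length) (hi : i < lam.pos[j]) (r : ℕ) :
    (lam.rep ^ r) ((lam.cut j : ℤ) + 1 + i) = (lam.cut j : ℤ) + 1 + ((i + r) % lam.pos[j] : ℕ) := by
  induction r with
  | zero => rw [pow_zero, Equiv.Perm.one_apply, add_zero, Nat.mod_eq_of_lt hi]
  | succ r ih =>
    rw [pow_succ', Equiv.Perm.mul_apply, ih, lam.rep_apply_pos hj (Nat.mod_lt _ (lam.part_pos hj)),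
      Nat.mod_add_mod, add_assoc i r 1]

theorem rep_apply_neg {j : ℕ} (hj : j < lam.neg.length) {x : ℤ}
    (h1 : ((lam.neg.take j).sum : ℤ) < |x|) (h2 : |x| ≤ (lam.neg.take j).sum + lam.neg[j]) :
    lam.rep x = negCycle (block (lam.neg.take j).sum lam.neg[j]) x := by
  have h3 := sum_take_succ lam.neg hj
  have h4 := sum_take_mono lam.neg (Nat.succ_le_of_lt hj)
  rw [List.take_length, Nat.succ_eq_add_one] at h4
  rw [rep, mul_apply_of_annulus lam.rep_pos_mem (by lia),
    cycleProd_apply negCycle_block_mem 0 lam.neg hj (by lia) (by lia), zero_add]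

theorem exists_rep_pow_eq_neg {x : ℤ} (hx : |x| ≤ lam.neg.sum) : ∃ r : ℕ, (lam.rep ^ r) x = -x := by
  have key : ∀ y : ℤ, 0 < y → y ≤ lam.neg.sum → ∃ r : ℕ, (lam.rep ^ r) y = -y := by
    intro y h1 h2
    obtain ⟨j, hj, h3, h4⟩ := exists_sum_take lam.neg (y := y.toNat) (by lia) (by lia)
    rw [sum_take_succ _ hj] at h4
    obtain ⟨i, hi, hy⟩ := exists_offset (o := (lam.neg.take j).sum) (m := lam.neg[j]) (x := y)
      (by lia) (by lia)
    have hpow : ∀ r : ℕ, (lam.rep ^ r) y =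
        (negCycle (block (lam.neg.take j).sum lam.neg[j]) ^ r) y := by
      intro r
      induction r with
      | zero => rfl
      | succ r ih =>
        have hmem := pow_mem (negCycle_block_mem (lam.neg.take j).sum lam.neg[j]) r
        have e1 := annulus_le_iff hmem y
        have e2 := groupB_abs_le_iff hmem.1 y
        rw [abs_of_pos h1] at e1 e2
        rw [Nat.cast_add] at e2
        rw [pow_succ', Equiv.Perm.mul_apply, ih, pow_succ', Equiv.Perm.mul_apply,
          lam.rep_apply_neg hj (by lia) (by lia)]
    refine ⟨lam.neg[j], ?_⟩
    rw [hpow, hy, negCycle_block_pow_apply hi]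
  rcases lt_trichotomy x 0 with h | rfl | h
  · rw [abs_of_neg h] at hx
    obtain ⟨r, hr⟩ := key (-x) (by lia) hx
    refine ⟨r, ?_⟩
    rw [(pow_mem lam.rep_mem_groupB r).1] at hr
    lia
  · exact ⟨0, by simp⟩
  · rw [abs_of_pos h] at hx
    exact key x h hx

/-- Holds because `w_λ` splits at the end of the `j`-th negative cycle into two factors with
disjoint supports; it is what makes `t(0, k)` commute with `w_λ`. -/
theorem rep_abs_le_iff (j : ℕ) (x : ℤ) :
    |lam.rep x| ≤ lam.negPartialSum j ↔ |x| ≤ lam.negPartialSum j := by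
  have hA : cycleProd negCycle 0 (lam.neg.take j) ∈ groupB (lam.negPartialSum j) := by
    have := (cycleProd_negCycle_mem 0 (lam.neg.take j)).1
    rwa [zero_add] at this
  have hB : cycleProd negCycle (0 + lam.negPartialSum j) (lam.neg.drop j) *
      cycleProd posCycle lam.neg.sum lam.pos ∈ annulus (lam.negPartialSum j) n := by
    have hs : lam.negPartialSum j + (lam.neg.drop j).sum = lam.neg.sum := by
      rw [negPartialSum, ← List.sum_append, List.take_append_drop]
    have h1 := cycleProd_negCycle_mem (0 + lam.negPartialSum j) (lam.neg.drop j)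
    rw [zero_add] at h1 ⊢
    have := lam.neg_sum_le
    exact mul_mem (annulus_mono le_rfl (by lia) h1) (annulus_mono (by lia) le_rfl lam.rep_pos_mem)
  have e : lam.rep = cycleProd negCycle 0 (lam.neg.take j) *
      (cycleProd negCycle (0 + lam.negPartialSum j) (lam.neg.drop j) *
      cycleProd posCycle lam.neg.sum lam.pos) := by
    rw [← mul_assoc, negPartialSum, ← cycleProd_append, List.take_append_drop, rep]
  rw [e, Equiv.Perm.mul_apply, groupB_abs_le_iff hA, annulus_le_iff hB]

theorem negPartialSum_length : lam.negPartialSum lam.neg.length = lam.neg.sum := by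
  rw [negPartialSum, List.take_length]

theorem rep_abs_le_neg_sum_iff (x : ℤ) : |lam.rep x| ≤ lam.neg.sum ↔ |x| ≤ lam.neg.sum := by
  rw [← negPartialSum_length, rep_abs_le_iff]

/-! ### The parabolic subgroup of `w_λ` -/

/-- The ends of the positive cycles of `w_λ`, together with the end of the negative part. -/
def cuts : Set ℕ := {c | ∃ j ≤ lam.pos.length, c = lam.cut j}

theorem neg_eq_nil_or_two_le_sum (h : Even lam.neg.length) : lam.neg = [] ∨ 2 ≤ lam.neg.sum := by
  have hp := lam.neg_parts
  match hl : lam.neg with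
  | [] => exact Or.inl rfl
  | [a] => rw [hl] at h; simp at h
  | a :: b :: l =>
    right
    rw [hl] at hp
    have h1 := hp a (by simp)
    have h2 := hp b (by simp)
    simp only [List.sum_cons]
    lia

theorem rep_apply_of_notMem_cuts {i : ℕ} (h1 : lam.neg.sum < i) (h2 : i ≤ n) (h : i ∉ lam.cuts) :
    lam.rep i = i + 1 := by
  obtain ⟨j, hj, a, ha, hi⟩ := lam.exists_cut (x := i) (by lia) (by lia)
  have hne : i ≠ lam.cut (j + 1) := fun e => h ⟨j + 1, hj, e⟩
  have := lam.cut_succ hj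
  rw [hi, lam.rep_apply_pos hj ha, Nat.mod_eq_of_lt (by lia)]
  push_cast
  ring

theorem rep_notMem_setStab {A : Set ℤ} {x : ℤ} (hx : |x| ≤ lam.neg.sum) (h1 : x ∈ A)
    (h2 : -x ∉ A) : lam.rep ∉ setStab A := by
  intro h
  obtain ⟨r, hr⟩ := lam.exists_rep_pow_eq_neg hx
  rw [← hr, mem_setStab.1 (pow_mem h r)] at h2
  exact h2 h1

theorem exists_index_of_cut_lt {j : ℕ} {x : ℤ} (h1 : (lam.cut j : ℤ) < x) (h2 : x ≤ n) :
    ∃ j', ∃ hj' : j' < lam.pos.length, ∃ i < lam.pos[j'],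
      j ≤ j' ∧ x = (lam.cut j' : ℤ) + 1 + (i : ℕ) := by
  have h0 := lam.le_cut j
  obtain ⟨j', hj', i, hi, rfl⟩ := lam.exists_cut (x := x) (by lia) h2
  refine ⟨j', hj', i, hi, ?_, rfl⟩
  by_contra hlt
  have := lam.cut_mono (Nat.succ_le_of_lt (not_le.1 hlt))
  have := lam.cut_succ hj'
  lia

theorem rep_mem_setStab_cut (j : ℕ) : lam.rep ∈ setStab (Set.Ioi (lam.cut j : ℤ)) := by
  refine mem_setStab_Ioi lam.rep_mem_groupB fun x hx => ?_
  by_cases hxn : x ≤ n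
  · obtain ⟨j', hj', i, hi, hjj, rfl⟩ := lam.exists_index_of_cut_lt hx hxn
    rw [lam.rep_apply_pos hj' hi]
    have := lam.cut_mono hjj
    lia
  · rwa [lam.rep_mem_groupB.2 x (by rw [abs_of_pos (by lia)]; lia)]

theorem mem_cutStab_cuts {g : Equiv.Perm ℤ} : g ∈ cutStab n lam.cuts ↔ g ∈ groupD n ∧
    ∀ j ≤ lam.pos.length, ∀ x : ℤ, (lam.cut j : ℤ) < g x ↔ (lam.cut j : ℤ) < x := by
  rw [mem_cutStab]
  refine and_congr_right fun _ => ⟨fun h j hj => h _ ⟨j, hj, rfl⟩, ?_⟩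
  rintro h c ⟨j, hj, rfl⟩
  exact h j hj

/-- Inside the negative part, an orbit containing `x` and `-x` rules out every asymmetric stable
set; inside a positive cycle, the step from `i` to `i + 1` crosses the cut at `i`. An even number of
negative cycles ensures that the negative part is empty or has at least two points, as the
exceptional set at `1` requires. -/
theorem parabolicD_rep (hn : 2 ≤ n) (h : Even lam.neg.length) :
    parabolicD n lam.rep = cutStab n lam.cuts := by
  apply parabolicD_eq_cutStab hn
  · exact lam.mem_cutStab_cuts.2 ⟨lam.rep_mem_groupD h, fun j _ => lam.rep_mem_setStab_cut j⟩
  · intro i hi hc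
    rcases lt_trichotomy i lam.neg.sum with hlt | rfl | hlt
    · have h1 : (i : ℤ) < lam.neg.sum := Int.ofNat_lt.2 hlt
      have h2 : ¬ (i : ℤ) < -lam.neg.sum := by lia
      exact lam.rep_notMem_setStab (x := lam.neg.sum) (Nat.abs_cast _).le h1 h2
    · exact absurd ⟨0, Nat.zero_le _, lam.cut_zero.symm⟩ hc
    · intro hs
      have := hs i
      rw [lam.rep_apply_of_notMem_cuts hlt hi.le hc, Set.mem_Ioi, Set.mem_Ioi] at this
      lia
  · intro hc
    rcases lam.neg_eq_nil_or_two_le_sum h with h0 | h2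
    · intro hs
      have := hs ((1 : ℕ) : ℤ)
      rw [lam.rep_apply_of_notMem_cuts (by simp [h0]) (by lia) hc] at this
      norm_num at this
    · exact lam.rep_notMem_setStab (x := -1) (by rw [abs_neg, abs_one]; lia) (Or.inl rfl)
        (by norm_num)

end DoublePartition

/-! ### Complements and auxiliary commutation facts -/

theorem isComplementIn_of {N H G : Subgroup (Equiv.Perm ℤ)} (hH : H ≤ G) (hN : N ≤ G)
    (h1 : ∀ x ∈ N, x ∈ H → x = 1) (h2 : ∀ g ∈ G, ∃ q ∈ N, q * g ∈ H) : IsComplementIn N H G := by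
  refine ⟨hH, hN, Subgroup.isComplement'_of_disjoint_and_mul_eq_univ ?_ ?_⟩
  · rw [Subgroup.disjoint_def]
    intro x hxH hxN
    exact Subtype.ext (h1 x hxN hxH)
  · rw [Set.eq_univ_iff_forall]
    intro g
    -- The hypothesis puts the element of `N` on the left; passing to inverses yields the
    -- factorization `g = (q * g⁻¹)⁻¹ * q` with the factors in the required order.
    obtain ⟨q, hq, hqg⟩ := h2 g⁻¹ (inv_mem g.2)
    refine ⟨⟨(q * g⁻¹)⁻¹, hH (inv_mem hqg)⟩, ?_, ⟨q, hN hq⟩, ?_, ?_⟩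
    · exact Subgroup.mem_subgroupOf.2 (inv_mem hqg)
    · exact Subgroup.mem_subgroupOf.2 hq
    · ext1
      simp

theorem abs_apply_le_iff_of_setStab {n : ℕ} {g : Equiv.Perm ℤ} (hg : g ∈ groupB n) {c : ℕ}
    (h : g ∈ setStab (Set.Ioi (c : ℤ))) (x : ℤ) : |g x| ≤ c ↔ |x| ≤ c := by
  have h1 := h x
  have h2 := h (-x)
  rw [Set.mem_Ioi, Set.mem_Ioi] at h1 h2
  rw [hg.1] at h2
  rw [abs_le, abs_le]
  lia

theorem blockNeg_commute {n o m : ℕ} {g : Equiv.Perm ℤ} (hg : g ∈ groupB n)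
    (h1 : ∀ x : ℤ, |g x| ≤ (o : ℤ) ↔ |x| ≤ (o : ℤ))
    (h2 : ∀ x : ℤ, |g x| ≤ ((o + m : ℕ) : ℤ) ↔ |x| ≤ ((o + m : ℕ) : ℤ)) :
    Commute (blockNeg o m) g := by
  ext x
  have e1 := h1 x
  have e2 := h2 x
  rw [Equiv.Perm.mul_apply, Equiv.Perm.mul_apply, blockNeg_apply, blockNeg_apply]
  rw [Nat.cast_add] at e2
  by_cases hc : (o : ℤ) < |x| ∧ |x| ≤ o + m
  · rw [if_pos hc, if_pos (by lia), hg.1]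
  · rw [if_neg hc, if_neg (by lia)]

theorem blockNeg_mul_self (o m : ℕ) : blockNeg o m * blockNeg o m = 1 := by
  ext x
  have := blockNeg_apply o m (-x)
  rw [Equiv.Perm.mul_apply, blockNeg_apply o m x]
  split_ifs with h
  · rw [this, abs_neg, if_pos h, neg_neg, Equiv.Perm.one_apply]
  · rw [blockNeg_apply, if_neg h, Equiv.Perm.one_apply]

theorem blockNeg_mem_setStab (o m : ℕ) {A : Set ℤ} (hA : ∀ x, -x ∈ A ↔ x ∈ A) :
    blockNeg o m ∈ setStab A := by
  intro x
  rw [blockNeg_apply]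
  split_ifs
  · exact hA x
  · exact Iff.rfl

/-- The permutations that agree with the identity or with `z` on the integers `x`, `|x| ≤ k`. -/
def idOrOn (k : ℕ) (z : Equiv.Perm ℤ) (hz : z * z = 1) (hk : z ∈ groupB k) :
    Subgroup (Equiv.Perm ℤ) where
  carrier := {g | (∀ x : ℤ, |x| ≤ k → g x = x) ∨ ∀ x : ℤ, |x| ≤ k → g x = z x}
  one_mem' := Or.inl fun _ _ => rfl
  mul_mem' := by
    have hzz : ∀ x, z (z x) = x := fun x => by rw [← Equiv.Perm.mul_apply, hz, Equiv.Perm.one_apply]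
    have hzk : ∀ x : ℤ, |x| ≤ k → |z x| ≤ k := fun x => (groupB_abs_le_iff hk x).2
    rintro g h (hg | hg) (hh | hh)
    · exact Or.inl fun x hx => by rw [Equiv.Perm.mul_apply, hh x hx, hg x hx]
    · exact Or.inr fun x hx => by rw [Equiv.Perm.mul_apply, hh x hx, hg _ (hzk x hx)]
    · exact Or.inr fun x hx => by rw [Equiv.Perm.mul_apply, hh x hx, hg x hx]
    · exact Or.inl fun x hx => by rw [Equiv.Perm.mul_apply, hh x hx, hg _ (hzk x hx), hzz]
  inv_mem' := by
    have hzz : ∀ x, z (z x) = x := fun x => by rw [← Equiv.Perm.mul_apply, hz, Equiv.Perm.one_apply]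
    have hzk : ∀ x : ℤ, |x| ≤ k → |z x| ≤ k := fun x => (groupB_abs_le_iff hk x).2
    rintro g (hg | hg)
    · exact Or.inl fun x hx => by rw [Equiv.Perm.inv_eq_iff_eq, hg x hx]
    · exact Or.inr fun x hx => by rw [Equiv.Perm.inv_eq_iff_eq, hg _ (hzk x hx), hzz]

/-! ### Generators of `N` in terms of the cuts -/

namespace DoublePartition

variable {n : ℕ} (lam : DoublePartition n)

theorem groupNPlus_zero : lam.groupNPlus 0 = lam.groupN := by
  have h : blockNeg 0 0 = 1 := rfl
  simp only [groupNPlus, groupN, h, one_pow, one_mul]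

theorem cut_lt_cut {i j : ℕ} (h : i < j) (hj : j ≤ lam.pos.length) : lam.cut i < lam.cut j := by
  have h1 := lam.cut_mono (Nat.succ_le_of_lt h)
  have h2 := lam.cut_succ (j := i) (by lia)
  have h3 := lam.part_pos (j := i) (by lia)
  rw [Nat.succ_eq_add_one] at h1
  lia

theorem offset_eq_cut {j : ℕ} (hj : j < lam.pos.length) :
    ∃ i < lam.mult lam.pos[j], lam.cut j = lam.offset lam.pos[j] + i * lam.pos[j] := by
  obtain ⟨i, hi, hs⟩ := sum_take_eq_of_sorted lam.pos_sorted hj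
  refine ⟨i, hi, ?_⟩
  rw [cut, offset, hs, add_assoc]
  rfl

theorem exists_cut_eq_offset {m i : ℕ} (hi : i < lam.mult m) :
    ∃ j, ∃ hj : j < lam.pos.length, lam.pos[j] = m ∧ lam.cut j = lam.offset m + i * m := by
  obtain ⟨j, hj, h1, h2⟩ := exists_sum_take_of_sorted lam.pos_sorted hi
  refine ⟨j, hj, h1, ?_⟩
  rw [cut, offset, h2, add_assoc]
  rfl

theorem part_le {j : ℕ} (hj : j < lam.pos.length) : lam.pos[j] ≤ n := by
  have h1 := lam.cut_succ hj
  have h2 := lam.cut_le (j + 1)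
  lia

theorem part_mono {i j : ℕ} (h : i ≤ j) (hj : j < lam.pos.length) : lam.pos[i] ≤ lam.pos[j] := by
  rcases h.eq_or_lt with rfl | h
  · exact le_rfl
  · exact List.pairwise_iff_getElem.1 lam.pos_sorted i j (by lia) hj h

variable {lam} in
-- Only the first block of each length has its sign change among the generators, so the index `i` is
-- that of the first cycle as long as the `j`-th.
theorem exists_blockNeg_mem (k : ℕ) {j : ℕ} (hj : j < lam.pos.length) :
    ∃ i, ∃ _ : i ≤ j, lam.pos[i] = lam.pos[j] ∧
      blockNeg 0 k ^ lam.pos[j] * blockNeg (lam.cut i) lam.pos[j] ∈ lam.groupNPlus k := by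
  obtain ⟨a, ha, hja⟩ := lam.offset_eq_cut hj
  obtain ⟨i, hi, h1, h2⟩ := lam.exists_cut_eq_offset (m := lam.pos[j]) (i := 0) (by lia)
  have hij : i ≤ j := by
    by_contra hlt
    have := lam.cut_lt_cut (not_le.1 hlt) hi.le
    lia
  refine ⟨i, hij, h1, ?_⟩
  rw [h2, zero_mul, add_zero]
  exact Subgroup.subset_closure ⟨_, lam.part_pos hj, lam.part_le hj, by lia, Or.inl rfl⟩

variable {lam} in
theorem blockSwap_mem_groupNPlus (k : ℕ) {j : ℕ} (hj : j + 1 < lam.pos.length)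
    (h : lam.pos[j] = lam.pos[j + 1]) : blockSwap (lam.cut j) lam.pos[j] ∈ lam.groupNPlus k := by
  obtain ⟨a, ha, hja⟩ := lam.offset_eq_cut (j := j) (by lia)
  obtain ⟨b, hb, hjb⟩ := lam.offset_eq_cut hj
  have h1 := lam.cut_succ (j := j) (by lia)
  have hp := lam.part_pos (j := j) (by lia)
  rw [← h] at hb hjb
  have hab : b = a + 1 := by
    have : b * lam.pos[j] = (a + 1) * lam.pos[j] := by
      rw [add_mul]
      lia
    exact Nat.eq_of_mul_eq_mul_right hp this
  rw [hja]
  exact Subgroup.subset_closure ⟨_, hp, lam.part_le _, by lia, Or.inr ⟨a, by lia, rfl⟩⟩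

variable {lam} in
theorem groupNPlus_le {k : ℕ} {H : Subgroup (Equiv.Perm ℤ)}
    (h1 : ∀ j (hj : j < lam.pos.length),
      blockNeg 0 k ^ lam.pos[j] * blockNeg (lam.cut j) lam.pos[j] ∈ H)
    (h2 : ∀ j (hj : j + 1 < lam.pos.length), lam.pos[j] = lam.pos[j + 1] →
      blockSwap (lam.cut j) lam.pos[j] ∈ H) : lam.groupNPlus k ≤ H := by
  rw [groupNPlus, Subgroup.closure_le]
  rintro g ⟨m, hm, -, ha, rfl | ⟨i, hi, rfl⟩⟩
  · obtain ⟨j, hj, rfl, hc⟩ := lam.exists_cut_eq_offset ha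
    rw [zero_mul, add_zero] at hc
    rw [← hc]
    exact h1 j hj
  · obtain ⟨j, hj, hjm, hc⟩ := lam.exists_cut_eq_offset (m := m) (i := i) (by lia)
    obtain ⟨j', hj', hjm', hc'⟩ := lam.exists_cut_eq_offset (m := m) (i := i + 1) (by lia)
    have e : lam.cut j' = lam.cut (j + 1) := by
      rw [lam.cut_succ hj, hc, hc', hjm]
      ring
    have hjj : j' = j + 1 := by
      rcases lt_trichotomy j' (j + 1) with h | h | h
      · have := lam.cut_lt_cut h hj
        lia
      · exact h
      · have := lam.cut_lt_cut h hj'.le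
        lia
    subst hjj
    rw [← hc]
    have := h2 j hj' (by rw [hjm, hjm'])
    rwa [hjm] at this

theorem negPartialSum_le (j : ℕ) : lam.negPartialSum j ≤ lam.neg.sum := by
  rcases le_total j lam.neg.length with h | h
  · have := sum_take_mono lam.neg h
    rwa [List.take_length] at this
  · rw [negPartialSum, List.take_of_length_le h]

theorem blockNeg_zero_mem (j : ℕ) : blockNeg 0 (lam.negPartialSum j) ∈ groupB lam.neg.sum := by
  have := (blockNeg_mem 0 (lam.negPartialSum j)).1
  rw [zero_add] at this
  exact groupB_mono (lam.negPartialSum_le j) this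

theorem blockNeg_cut_mem {j : ℕ} (hj : j < lam.pos.length) :
    blockNeg (lam.cut j) lam.pos[j] ∈ annulus (lam.cut j) (lam.cut (j + 1)) := by
  rw [lam.cut_succ hj]
  exact blockNeg_mem _ _

theorem blockSwap_cut_mem {j : ℕ} (hj : j + 1 < lam.pos.length) (h : lam.pos[j] = lam.pos[j + 1]) :
    blockSwap (lam.cut j) lam.pos[j] ∈ annulus (lam.cut j) (lam.cut (j + 2)) := by
  rw [lam.cut_succ hj, lam.cut_succ (j := j) (by lia), ← h, add_assoc, ← two_mul]
  exact blockSwap_mem _ _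

variable {lam} in
-- Blocks of equal length are exchanged by translation, preserving the position inside the cycle.
-- Both the commutation with `w_λ` and the stability of the first points rest on this.
theorem blockSwap_cut_apply {j : ℕ} (hj : j + 1 < lam.pos.length) (h : lam.pos[j] = lam.pos[j + 1])
    {j' : ℕ} (hj' : j' < lam.pos.length) :
    ∃ j'', ∃ hj'' : j'' < lam.pos.length, lam.pos[j''] = lam.pos[j'] ∧ ∀ i < lam.pos[j'],
      blockSwap (lam.cut j) lam.pos[j] ((lam.cut j' : ℤ) + 1 + (i : ℕ)) =
        (lam.cut j'' : ℤ) + 1 + (i : ℕ) := by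
  have h1 := lam.cut_succ (j := j) (by lia)
  have h2 := lam.cut_succ hj
  rcases lt_trichotomy j' j with hlt | rfl | hlt
  · refine ⟨j', hj', rfl, fun i hi => ?_⟩
    have h3 := lam.cut_succ hj'
    have h4 := lam.cut_mono (Nat.succ_le_of_lt hlt)
    rw [Nat.succ_eq_add_one] at h4
    exact blockSwap_apply_of_pos_le (by lia) (by lia)
  · refine ⟨j' + 1, hj, h.symm, fun i hi => ?_⟩
    rw [blockSwap_apply_left (by lia) (by lia), h1]
    push_cast
    ring
  · rcases (Nat.succ_le_of_lt hlt).eq_or_lt with rfl | hlt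
    · refine ⟨j, by lia, h, fun i hi => ?_⟩
      simp only [Nat.succ_eq_add_one] at *
      rw [blockSwap_apply_right (by lia) (by lia), h1]
      push_cast
      ring
    · refine ⟨j', hj', rfl, fun i hi => ?_⟩
      have h4 := lam.cut_mono (Nat.succ_le_of_lt hlt)
      simp only [Nat.succ_eq_add_one] at h4
      exact blockSwap_apply_of_lt (by lia)

/-! ### Invariants of `N` and the trivial intersection -/

theorem groupNPlus_le_groupB (j : ℕ) : lam.groupNPlus (lam.negPartialSum j) ≤ groupB n := by
  refine groupNPlus_le (fun i hi => mul_mem (pow_mem (groupB_mono lam.neg_sum_le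
    (lam.blockNeg_zero_mem j)) _) ?_) fun i hi h => ?_
  · exact groupB_mono (lam.cut_le _) (lam.blockNeg_cut_mem hi).1
  · exact groupB_mono (lam.cut_le _) (lam.blockSwap_cut_mem hi h).1

theorem rep_abs_le_cut_iff (j : ℕ) (x : ℤ) : |lam.rep x| ≤ lam.cut j ↔ |x| ≤ lam.cut j :=
  abs_apply_le_iff_of_setStab lam.rep_mem_groupB (lam.rep_mem_setStab_cut j) x

theorem blockNeg_zero_commute (j : ℕ) : Commute (blockNeg 0 (lam.negPartialSum j)) lam.rep := by
  refine blockNeg_commute lam.rep_mem_groupB (lam.rep_abs_le_iff 0) ?_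
  rw [zero_add]
  exact lam.rep_abs_le_iff j

theorem blockSwap_commute {j : ℕ} (hj : j + 1 < lam.pos.length) (h : lam.pos[j] = lam.pos[j + 1]) :
    Commute (blockSwap (lam.cut j) lam.pos[j]) lam.rep := by
  have hs := lam.blockSwap_cut_mem hj h
  have hsB := groupB_mono (lam.cut_le _) hs.1
  refine groupB_ext (mul_mem hsB lam.rep_mem_groupB) (mul_mem lam.rep_mem_groupB hsB)
    fun x hx hxn => ?_
  rw [Equiv.Perm.mul_apply, Equiv.Perm.mul_apply]
  by_cases hk : x ≤ lam.neg.sum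
  · have h1 := lam.le_cut j
    have h2 := (lam.rep_abs_le_neg_sum_iff x).2 (by rwa [abs_of_pos (by lia)])
    rw [hs.2 x (by rw [abs_of_pos (by lia)]; lia), hs.2 _ (by lia)]
  · obtain ⟨j', hj', i, hi, rfl⟩ := lam.exists_cut (x := x) (by lia) hxn
    obtain ⟨j'', hj'', hp, he⟩ := blockSwap_cut_apply hj h hj'
    rw [he i hi, lam.rep_apply_pos hj' hi, he _ (Nat.mod_lt _ (by lia)),
      lam.rep_apply_pos hj'' (by lia), hp]

theorem groupNPlus_le_centralizer (j : ℕ) :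
    lam.groupNPlus (lam.negPartialSum j) ≤ Subgroup.centralizer {lam.rep} := by
  refine groupNPlus_le (fun i hi => mul_mem (pow_mem ?_ _) ?_) fun i hi h => ?_ <;>
    rw [Subgroup.mem_centralizer_singleton_iff]
  · exact lam.blockNeg_zero_commute j
  · refine blockNeg_commute lam.rep_mem_groupB (lam.rep_abs_le_cut_iff i) ?_
    rw [← lam.cut_succ hi]
    exact lam.rep_abs_le_cut_iff (i + 1)
  · exact lam.blockSwap_commute hi h

/-- The first points of the positive cycles of `w_λ`, and their negatives. -/
def firsts : Set ℤ := {x | ∃ j < lam.pos.length, x = lam.cut j + 1 ∨ x = -(lam.cut j + 1)}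

theorem finite_firsts : lam.firsts.Finite := by
  refine (Set.finite_Icc (-(n + 1 : ℤ)) (n + 1)).subset ?_
  rintro x ⟨j, -, rfl | rfl⟩ <;> have := lam.cut_le j <;> rw [Set.mem_Icc] <;> lia

theorem neg_mem_firsts (x : ℤ) : -x ∈ lam.firsts ↔ x ∈ lam.firsts := by
  have h : ∀ x, x ∈ lam.firsts → -x ∈ lam.firsts := by
    rintro x ⟨j, hj, rfl | rfl⟩
    · exact ⟨j, hj, Or.inr rfl⟩
    · exact ⟨j, hj, Or.inl (neg_neg _)⟩
  exact ⟨fun hx => neg_neg x ▸ h _ hx, h x⟩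

theorem groupNPlus_le_setStab_firsts (k : ℕ) : lam.groupNPlus k ≤ setStab lam.firsts := by
  refine groupNPlus_le (fun i hi => mul_mem (pow_mem ?_ _) ?_) fun i hi h => ?_
  · exact blockNeg_mem_setStab _ _ lam.neg_mem_firsts
  · exact blockNeg_mem_setStab _ _ lam.neg_mem_firsts
  · have key : ∀ j < lam.pos.length,
        blockSwap (lam.cut i) lam.pos[i] (lam.cut j + 1) ∈ lam.firsts := by
      intro j hj
      obtain ⟨j', hj', -, he⟩ := blockSwap_cut_apply hi h hj
      have := he 0 (lam.part_pos hj)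
      rw [Nat.cast_zero, add_zero, add_zero] at this
      rw [this]
      exact ⟨j', hj', Or.inl rfl⟩
    refine mem_setStab_of_finite lam.finite_firsts ?_
    rintro x ⟨j, hj, rfl | rfl⟩
    · exact key j hj
    · rw [(lam.blockSwap_cut_mem hi h).1.1, lam.neg_mem_firsts]
      exact key j hj

theorem groupNPlus_le_idOrOn (j : ℕ) : lam.groupNPlus (lam.negPartialSum j) ≤
    idOrOn lam.neg.sum (blockNeg 0 (lam.negPartialSum j)) (blockNeg_mul_self _ _)
      (lam.blockNeg_zero_mem j) := by
  refine groupNPlus_le (fun i hi => mul_mem (pow_mem ?_ _) ?_) fun i hi h => ?_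
  · exact Or.inr fun x _ => rfl
  · have := lam.le_cut i
    exact Or.inl fun x hx => (lam.blockNeg_cut_mem hi).2 x (by lia)
  · have := lam.le_cut i
    exact Or.inl fun x hx => (lam.blockSwap_cut_mem hi h).2 x (by lia)

theorem apply_eq_self_of_mem {j : ℕ} {q : Equiv.Perm ℤ}
    (hq : q ∈ lam.groupNPlus (lam.negPartialSum j)) (hc : q ∈ cutStab n lam.cuts) {x : ℤ}
    (h1 : (lam.neg.sum : ℤ) < x) (h2 : x ≤ n) : q x = x := by
  rw [lam.mem_cutStab_cuts] at hc
  have hfirst : ∀ i < lam.pos.length, q (lam.cut i + 1) = lam.cut i + 1 := by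
    intro i hi
    have hs := lam.cut_succ hi
    have hp := lam.part_pos hi
    have h3 := hc.2 i hi.le (lam.cut i + 1)
    have h4 := hc.2 (i + 1) hi (lam.cut i + 1)
    -- The image is again a first point up to sign, and it lies between the same two cuts, where
    -- there is only one candidate.
    obtain ⟨i', hi', he⟩ :=
      (lam.groupNPlus_le_setStab_firsts _ hq (lam.cut i + 1)).2 ⟨i, hi, Or.inl rfl⟩
    have hs' := lam.cut_succ hi'
    have hp' := lam.part_pos hi'
    have hii : i' = i :=
      lam.cut_index_unique (x := q (lam.cut i + 1)) (by lia) (by lia) (by lia) (by lia)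
    subst hii
    lia
  obtain ⟨i, hi, a, ha, rfl⟩ := lam.exists_cut h1 h2
  have hcomm := (Subgroup.mem_centralizer_singleton_iff.1 (lam.groupNPlus_le_centralizer j hq))
  have hpow : q * lam.rep ^ a = lam.rep ^ a * q := Commute.pow_right hcomm a
  have hpt := lam.rep_pow_apply_pos hi (lam.part_pos hi) a
  rw [Nat.cast_zero, add_zero, zero_add, Nat.mod_eq_of_lt ha] at hpt
  rw [← hpt, ← Equiv.Perm.mul_apply, hpow, Equiv.Perm.mul_apply, hfirst i hi]

theorem eq_one_of_mem {j : ℕ} (hj : lam.negPartialSum j = 0 ∨ Odd (lam.negPartialSum j))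
    {q : Equiv.Perm ℤ} (hq : q ∈ lam.groupNPlus (lam.negPartialSum j))
    (hc : q ∈ cutStab n lam.cuts) : q = 1 := by
  have hB := lam.groupNPlus_le_groupB j hq
  have hz := lam.blockNeg_zero_mem j
  rcases lam.groupNPlus_le_idOrOn j hq with h | h
  · refine groupB_ext hB (one_mem _) fun x hx hxn => ?_
    by_cases hk : x ≤ lam.neg.sum
    · exact h x (by rwa [abs_of_pos (by lia)])
    · exact lam.apply_eq_self_of_mem hq hc (by lia) hxn
  · have hqz : q = blockNeg 0 (lam.negPartialSum j) := by
      refine groupB_ext hB (groupB_mono lam.neg_sum_le hz) fun x hx hxn => ?_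
      by_cases hk : x ≤ lam.neg.sum
      · exact h x (by rwa [abs_of_pos (by lia)])
      · rw [lam.apply_eq_self_of_mem hq hc (by lia) hxn, hz.2 x (by rw [abs_of_pos (by lia)]; lia)]
    -- The remaining candidate is `t(0, k)`: trivial for `k = 0`, of sign `-1` for odd `k`.
    rcases hj with h0 | hodd
    · rw [hqz, h0]
      rfl
    · have h1 := (mem_groupD_iff hB).1 (lam.mem_cutStab_cuts.1 hc).1
      have := lam.negPartialSum_le j
      have := lam.neg_sum_le
      rw [hqz, signProd_blockNeg (by lia), hodd.neg_one_pow] at h1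
      norm_num at h1

end DoublePartition

/-! ### Moving centralizer elements into the parabolic subgroup -/

theorem mem_setStab_Ioi_of_fixed {q : Equiv.Perm ℤ} {b c : ℤ} (hbc : b ≤ c)
    (h : ∀ x, b < x → q x = x) : q ∈ setStab (Set.Ioi c) := by
  intro x
  rw [Set.mem_Ioi, Set.mem_Ioi]
  constructor
  · intro hx
    rwa [q.injective (h (q x) (by lia))] at hx
  · intro hx
    rwa [h x (by lia)]

theorem mem_centralizerIn {H : Subgroup (Equiv.Perm ℤ)} {w g : Equiv.Perm ℤ} :
    g ∈ centralizerIn H w ↔ g ∈ H ∧ Commute g w := by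
  rw [centralizerIn, Subgroup.mem_inf, Subgroup.mem_centralizer_singleton_iff]
  rfl

theorem commute_apply_pow {g w : Equiv.Perm ℤ} (h : Commute g w) (r : ℕ) (x : ℤ) :
    g ((w ^ r) x) = (w ^ r) (g x) := by
  have : g * w ^ r = w ^ r * g := h.pow_right r
  rw [← Equiv.Perm.mul_apply, this, Equiv.Perm.mul_apply]

namespace DoublePartition

variable {n : ℕ} (lam : DoublePartition n)

theorem rep_pow_pos {x : ℤ} (hx : (lam.neg.sum : ℤ) < x) (r : ℕ) :
    (lam.neg.sum : ℤ) < (lam.rep ^ r) x := by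
  have h := pow_mem (lam.rep_mem_setStab_cut 0) r
  rw [cut_zero] at h
  exact (h x).2 hx

variable {lam} in
-- If `g x` lay in the negative part, some power of `w_λ` would negate it, and by commutation would
-- send `x` to `-x`; but powers of `w_λ` keep `x` beyond the negative part.
theorem lt_abs_apply_of_commute {g : Equiv.Perm ℤ} (hg : g ∈ groupB n) (hc : Commute g lam.rep)
    {x : ℤ} (hx : (lam.neg.sum : ℤ) < x) : (lam.neg.sum : ℤ) < |g x| := by
  by_contra hlt
  obtain ⟨r, hr⟩ := lam.exists_rep_pow_eq_neg (not_lt.1 hlt)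
  rw [← commute_apply_pow hc, ← hg.1] at hr
  have h1 := g.injective hr
  have h2 := lam.rep_pow_pos hx r
  lia

theorem rep_pow_fixed_iff {j i : ℕ} (hj : j < lam.pos.length) (hi : i < lam.pos[j]) (r : ℕ) :
    (lam.rep ^ r) ((lam.cut j : ℤ) + 1 + i) = (lam.cut j : ℤ) + 1 + i ↔ lam.pos[j] ∣ r := by
  rw [lam.rep_pow_apply_pos hj hi, add_right_inj, Nat.cast_inj]
  constructor
  · intro h
    have : i + r ≡ i + 0 [MOD lam.pos[j]] := by
      rw [Nat.ModEq, h, add_zero, Nat.mod_eq_of_lt hi]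
    exact (Nat.modEq_zero_iff_dvd).1 (Nat.ModEq.add_left_cancel' i this)
  · rintro ⟨a, rfl⟩
    rw [Nat.add_mul_mod_self_left, Nat.mod_eq_of_lt hi]

variable {lam} in
/-- An element of the centralizer of `w_λ` permutes the positive cycles up to sign. -/
theorem exists_block_of_commute {g : Equiv.Perm ℤ} (hg : g ∈ groupB n) (hc : Commute g lam.rep)
    {j : ℕ} (hj : j < lam.pos.length) : ∃ j', ∃ hj' : j' < lam.pos.length,
      lam.pos[j'] = lam.pos[j] ∧ ∃ e : ℤ, (e = 1 ∨ e = -1) ∧ ∀ x : ℤ, (lam.cut j : ℤ) < x →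
        x ≤ lam.cut (j + 1) → (lam.cut j' : ℤ) < e * g x ∧ e * g x ≤ lam.cut (j' + 1) := by
  have hp := lam.part_pos hj
  have hs := lam.cut_succ hj
  have hk := lam.le_cut j
  have hn := lam.cut_le (j + 1)
  have h1 := lt_abs_apply_of_commute hg hc (x := lam.cut j + 1) (by lia)
  have h2 := (groupB_abs_le_iff hg (lam.cut j + 1)).2 (by rw [abs_of_pos (by lia)]; lia)
  obtain ⟨e, he, hy⟩ : ∃ e : ℤ, (e = 1 ∨ e = -1) ∧ |g (lam.cut j + 1)| = e * g (lam.cut j + 1) := by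
    rcases abs_choice (g (lam.cut j + 1)) with h | h
    · exact ⟨1, Or.inl rfl, by rw [h, one_mul]⟩
    · exact ⟨-1, Or.inr rfl, by rw [h, neg_one_mul]⟩
  obtain ⟨j', hj', i', hi', hx⟩ := lam.exists_cut h1 h2
  rw [hy] at hx
  have hs' := lam.cut_succ hj'
  have hpow : ∀ r : ℕ, e * g ((lam.rep ^ r) (lam.cut j + 1)) =
      (lam.rep ^ r) ((lam.cut j' : ℤ) + 1 + i') := by
    intro r
    rw [← hx, commute_apply_pow hc]
    rcases he with rfl | rfl
    · rw [one_mul, one_mul]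
    · rw [neg_one_mul, neg_one_mul, (pow_mem lam.rep_mem_groupB r).1]
  -- Equal lengths come from equal periods: a power of `w_λ` fixes the first point of the cycle
  -- exactly when it fixes the image point.
  have hdvd : ∀ r : ℕ, lam.pos[j] ∣ r ↔ lam.pos[j'] ∣ r := by
    intro r
    rw [← lam.rep_pow_fixed_iff hj hp, ← lam.rep_pow_fixed_iff hj' hi', ← hpow, ← hx, Nat.cast_zero,
      add_zero, mul_right_inj' (by lia), g.injective.eq_iff]
  refine ⟨j', hj', Nat.dvd_antisymm ((hdvd _).1 dvd_rfl) ((hdvd _).2 dvd_rfl), e, he, ?_⟩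
  intro x h3 h4
  obtain ⟨i, hi, rfl⟩ := exists_offset (m := lam.pos[j]) h3 (by lia)
  have h5 := lam.rep_pow_apply_pos hj hp i
  rw [Nat.cast_zero, add_zero, zero_add, Nat.mod_eq_of_lt hi] at h5
  rw [← h5, hpow, lam.rep_pow_apply_pos hj' hi']
  have := Nat.mod_lt (i' + i) (lam.part_pos hj')
  lia

variable {lam} in
-- As the parts are sorted, all blocks from `i` to `j` have the same length, so a chain of adjacent
-- swaps carries one to the other. Fixing everything beyond keeps the later cuts intact.
theorem exists_shift_mem (k : ℕ) {i j : ℕ} (hij : i ≤ j) (hj : j < lam.pos.length)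
    (h : lam.pos[i] = lam.pos[j]) : ∃ q ∈ lam.groupNPlus k,
      (∀ x : ℤ, (lam.cut i : ℤ) < x → x ≤ lam.cut (i + 1) → q x = x + lam.cut j - lam.cut i) ∧
      ∀ x : ℤ, (lam.cut (j + 1) : ℤ) < x → q x = x := by
  induction j, hij using Nat.le_induction with
  | base =>
    refine ⟨1, one_mem _, fun x _ _ => ?_, fun _ _ => rfl⟩
    rw [Equiv.Perm.one_apply]
    lia
  | succ j hij ih =>
    have h1 := lam.part_mono hij (by lia)
    have h2 := lam.part_mono (Nat.le_add_right j 1) hj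
    have hsi := lam.cut_succ (j := i) (by lia)
    have hsj := lam.cut_succ (j := j) (by lia)
    have hsj' := lam.cut_succ hj
    have hjj : lam.pos[j] = lam.pos[j + 1] := by lia
    obtain ⟨q, hq, hq1, hq2⟩ := ih (by lia) (by lia)
    refine ⟨_, mul_mem (blockSwap_mem_groupNPlus k hj hjj) hq, fun x hx1 hx2 => ?_, fun x hx => ?_⟩
    · rw [Equiv.Perm.mul_apply, hq1 x hx1 hx2, blockSwap_apply_left (by lia) (by lia)]
      lia
    · rw [Equiv.Perm.mul_apply, hq2 x (by lia), blockSwap_apply_of_lt (by lia)]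

variable {lam} in
-- The generator negating the first block of the given length is conjugated by a shift to the `j`-th
-- block. Its factor `t(0, k)^m` acts only on the negative part and plays no role here.
theorem exists_negate_mem (s : ℕ) {j : ℕ} (hj : j < lam.pos.length) :
    ∃ q ∈ lam.groupNPlus (lam.negPartialSum s),
      (∀ x : ℤ, (lam.cut j : ℤ) < x → x ≤ lam.cut (j + 1) → q x = -x) ∧
      ∀ x : ℤ, (lam.cut (j + 1) : ℤ) < x → q x = x := by
  obtain ⟨i, hij, hi, ht⟩ := exists_blockNeg_mem (lam.negPartialSum s) hj
  obtain ⟨q, hq, hq1, hq2⟩ := exists_shift_mem (lam.negPartialSum s) hij hj hi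
  have hqB := lam.groupNPlus_le_groupB s hq
  have hsi := lam.cut_succ (j := i) (by lia)
  have hsj := lam.cut_succ hj
  have hmono := lam.cut_mono (j := j + 1) (i := i + 1) (by lia)
  have hki := lam.le_cut i
  have hz : ∀ x : ℤ, (lam.neg.sum : ℤ) < |x| →
      (blockNeg 0 (lam.negPartialSum s) ^ lam.pos[j]) x = x :=
    (pow_mem (lam.blockNeg_zero_mem s) lam.pos[j]).2
  refine ⟨_, mul_mem (mul_mem hq ht) (inv_mem hq), fun x hx1 hx2 => ?_, fun x hx => ?_⟩
  · have e : q⁻¹ x = x - lam.cut j + lam.cut i := by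
      rw [Equiv.Perm.inv_eq_iff_eq, hq1 _ (by lia) (by lia)]
      lia
    have habs : |x - lam.cut j + lam.cut i| = x - lam.cut j + lam.cut i := abs_of_pos (by lia)
    rw [Equiv.Perm.mul_apply, Equiv.Perm.mul_apply, Equiv.Perm.mul_apply, e, blockNeg_apply,
      if_pos (by lia), hz _ (by rw [abs_neg]; lia), hqB.1, hq1 _ (by lia) (by lia)]
    lia
  · have e : q⁻¹ x = x := by rw [Equiv.Perm.inv_eq_iff_eq, hq2 x hx]
    have habs : |x| = x := abs_of_pos (by lia)
    rw [Equiv.Perm.mul_apply, Equiv.Perm.mul_apply, Equiv.Perm.mul_apply, e, blockNeg_apply,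
      if_neg (by lia), hz _ (by lia), hq2 x hx]

variable {lam} in
/-- If `g` stabilises all cuts after the `j`-th positive cycle, then some `q * g` also stabilises
the cut before it. -/
theorem exists_mul_mem_setStab_step (s : ℕ) {g : Equiv.Perm ℤ} (hg : g ∈ groupB n)
    (hc : Commute g lam.rep) {j : ℕ} (hj : j < lam.pos.length)
    (hstab : ∀ i, j + 1 ≤ i → i ≤ lam.pos.length → g ∈ setStab (Set.Ioi (lam.cut i : ℤ))) :
    ∃ q ∈ lam.groupNPlus (lam.negPartialSum s), ∀ i, j ≤ i → i ≤ lam.pos.length →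
      q * g ∈ setStab (Set.Ioi (lam.cut i : ℤ)) := by
  obtain ⟨j', hj', hp, e, he, hmap⟩ := exists_block_of_commute hg hc hj
  have hsj := lam.cut_succ hj
  have hsj' := lam.cut_succ hj'
  have hpj := lam.part_pos hj
  have hjj : j' ≤ j := by
    by_contra hlt
    have h1 := hmap (lam.cut j + 1) (by lia) (by lia)
    have h2 := (abs_apply_le_iff_of_setStab hg (hstab (j + 1) le_rfl hj) (lam.cut j + 1)).2
      (by rw [abs_of_pos (by lia)]; lia)
    have h3 := lam.cut_mono (Nat.succ_le_of_lt (not_le.1 hlt))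
    rw [Nat.succ_eq_add_one] at h3
    rw [abs_le] at h2
    rcases he with rfl | rfl <;> lia
  obtain ⟨q₁, hq₁, h11, h12⟩ := exists_shift_mem (lam.negPartialSum s) hjj hj hp
  obtain ⟨q₂, hq₂, h21, h22⟩ : ∃ q ∈ lam.groupNPlus (lam.negPartialSum s),
      (∀ x : ℤ, (lam.cut j : ℤ) < x → x ≤ lam.cut (j + 1) → q x = e * x) ∧
      ∀ x : ℤ, (lam.cut (j + 1) : ℤ) < x → q x = x := by
    rcases he with rfl | rfl
    · exact ⟨1, one_mem _, fun x _ _ => (one_mul x).symm, fun _ _ => rfl⟩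
    · simpa only [neg_one_mul] using exists_negate_mem s hj
  have hq₁B := lam.groupNPlus_le_groupB s hq₁
  have hq₂B := lam.groupNPlus_le_groupB s hq₂
  have hlater : ∀ i, j + 1 ≤ i → i ≤ lam.pos.length →
      q₂ * q₁ * g ∈ setStab (Set.Ioi (lam.cut i : ℤ)) := by
    intro i hi hir
    have hle : (lam.cut (j + 1) : ℤ) ≤ lam.cut i := by exact_mod_cast lam.cut_mono hi
    exact mul_mem (mul_mem (mem_setStab_Ioi_of_fixed hle h22) (mem_setStab_Ioi_of_fixed hle h12))
      (hstab i hi hir)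
  refine ⟨_, mul_mem hq₂ hq₁, fun i hi hir => ?_⟩
  rcases hi.eq_or_lt with rfl | hi
  · refine mem_setStab_Ioi (mul_mem (mul_mem hq₂B hq₁B) hg) fun x hx => ?_
    by_cases hx' : x ≤ lam.cut (j + 1)
    · have h1 := hmap x hx hx'
      have h2 : q₁ (e * g x) = e * g x + lam.cut j - lam.cut j' := h11 _ h1.1 h1.2
      have h3 := h21 (q₁ (e * g x)) (by lia) (by lia)
      have h4 : e * q₂ (q₁ (e * g x)) = q₂ (q₁ (g x)) := by
        rcases he with rfl | rfl
        · rw [one_mul, one_mul]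
        · rw [neg_one_mul, neg_one_mul, hq₁B.1, hq₂B.1, neg_neg]
      have hee : e * e = 1 := by rcases he with rfl | rfl <;> rfl
      rw [Equiv.Perm.mul_apply, Equiv.Perm.mul_apply, ← h4, h3, ← mul_assoc, hee, one_mul]
      lia
    · have := (hlater (j + 1) le_rfl hj x).2 (not_le.1 hx')
      rw [Set.mem_Ioi] at this
      lia
  · exact hlater i hi hir

variable {lam} in
theorem exists_mul_mem_setStab (s : ℕ) {g : Equiv.Perm ℤ} (hg : g ∈ groupB n)
    (hc : Commute g lam.rep) {j : ℕ} (hj : j ≤ lam.pos.length) :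
    ∃ q ∈ lam.groupNPlus (lam.negPartialSum s), ∀ i, j ≤ i → i ≤ lam.pos.length →
      q * g ∈ setStab (Set.Ioi (lam.cut i : ℤ)) := by
  induction hj using Nat.decreasingInduction with
  | self =>
    refine ⟨1, one_mem _, fun i h1 h2 => ?_⟩
    obtain rfl : i = lam.pos.length := by lia
    rw [one_mul, cut_length]
    exact mem_setStab_Ioi hg fun x hx => by rwa [hg.2 x (by rwa [abs_of_pos (by lia)])]
  | of_succ j hj ih =>
    obtain ⟨q, hq, h⟩ := ih
    have hqc := Subgroup.mem_centralizer_singleton_iff.1 (lam.groupNPlus_le_centralizer s hq)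
    obtain ⟨q', hq', h'⟩ := exists_mul_mem_setStab_step s
      (mul_mem (lam.groupNPlus_le_groupB s hq) hg) (Commute.mul_left hqc hc) hj h
    refine ⟨q' * q, mul_mem hq' hq, fun i h1 h2 => ?_⟩
    rw [mul_assoc]
    exact h' i h1 h2

/-! ### Signs of the generators, and the three cases -/

theorem signProd_generator (s : ℕ) {j : ℕ} (hj : j < lam.pos.length) :
    signProd n (blockNeg 0 (lam.negPartialSum s) ^ lam.pos[j] * blockNeg (lam.cut j) lam.pos[j]) =
      ((-1) ^ lam.negPartialSum s) ^ lam.pos[j] * (-1) ^ lam.pos[j] := by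
  have hz := groupB_mono lam.neg_sum_le (lam.blockNeg_zero_mem s)
  have hle := lam.negPartialSum_le s
  have hle' := lam.neg_sum_le
  have hpow : ∀ r : ℕ, signProd n (blockNeg 0 (lam.negPartialSum s) ^ r) =
      ((-1) ^ lam.negPartialSum s) ^ r := by
    intro r
    induction r with
    | zero =>
      rw [pow_zero, pow_zero]
      exact signProd_of_pos fun x hx => hx
    | succ r ih => rw [pow_succ, signProd_mul (pow_mem hz r) hz, ih, signProd_blockNeg (by lia),
        pow_succ]
  have hs := lam.cut_succ hj
  have hn := lam.cut_le (j + 1)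
  rw [signProd_mul (pow_mem hz _) (groupB_mono hn (lam.blockNeg_cut_mem hj).1), hpow,
    signProd_blockNeg (by lia)]

theorem groupNPlus_le_groupD {s : ℕ}
    (h : Odd (lam.negPartialSum s) ∨ lam.negPartialSum s = 0 ∧ EvenParts lam.pos) :
    lam.groupNPlus (lam.negPartialSum s) ≤ groupD n := by
  refine groupNPlus_le (fun i hi => ?_) fun i hi he => ?_
  · rw [mem_groupD_iff (mul_mem (pow_mem (groupB_mono lam.neg_sum_le (lam.blockNeg_zero_mem s)) _)
      (groupB_mono (lam.cut_le _) (lam.blockNeg_cut_mem hi).1)), lam.signProd_generator s hi]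
    rcases h with h | ⟨h, hev⟩
    · rw [h.neg_one_pow, ← mul_pow]
      norm_num
    · rw [h, (hev _ (List.getElem_mem hi)).neg_one_pow]
      norm_num
  · rw [mem_groupD_iff (groupB_mono (lam.cut_le _) (lam.blockSwap_cut_mem hi he).1)]
    exact signProd_of_pos fun x hx => blockSwap_pos hx

theorem isComplementIn_groupNPlus (hn : 2 ≤ n) (hlam : Even lam.neg.length) {s : ℕ}
    (h : Odd (lam.negPartialSum s) ∨ lam.negPartialSum s = 0 ∧ EvenParts lam.pos) :
    IsComplementIn (lam.groupNPlus (lam.negPartialSum s))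
      (centralizerIn (parabolicD n lam.rep) lam.rep) (centralizerIn (groupD n) lam.rep) := by
  rw [lam.parabolicD_rep hn hlam]
  refine isComplementIn_of (inf_le_inf_right _ inf_le_left)
    (le_inf (lam.groupNPlus_le_groupD h) (lam.groupNPlus_le_centralizer s)) ?_ ?_
  · exact fun x hx hxH => lam.eq_one_of_mem (by tauto) hx hxH.1
  · intro g hg
    rw [mem_centralizerIn] at hg
    obtain ⟨q, hq, hqs⟩ := exists_mul_mem_setStab s hg.1.1 hg.2 (Nat.zero_le _)
    have hqc := Subgroup.mem_centralizer_singleton_iff.1 (lam.groupNPlus_le_centralizer s hq)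
    exact ⟨q, hq, mem_centralizerIn.2 ⟨lam.mem_cutStab_cuts.2
      ⟨mul_mem (lam.groupNPlus_le_groupD h hq) hg.1, fun i hi => hqs i (Nat.zero_le _) hi⟩,
      Commute.mul_left hqc hg.2⟩⟩

theorem negPartialSum_zero : lam.negPartialSum 0 = 0 := by simp [negPartialSum]

theorem isComplementIn_groupN_inf (hn : 2 ≤ n) (hlam : lam.neg = []) :
    IsComplementIn (lam.groupN ⊓ groupD n)
      (centralizerIn (parabolicD n lam.rep) lam.rep) (centralizerIn (groupD n) lam.rep) := by
  rw [lam.parabolicD_rep hn (by simp [hlam]), ← groupNPlus_zero, ← lam.negPartialSum_zero]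
  refine isComplementIn_of (inf_le_inf_right _ inf_le_left)
    (le_inf inf_le_right (inf_le_left.trans (lam.groupNPlus_le_centralizer 0))) ?_ ?_
  · exact fun x hx hxH => lam.eq_one_of_mem (Or.inl lam.negPartialSum_zero) hx.1 hxH.1
  · intro g hg
    rw [mem_centralizerIn] at hg
    obtain ⟨q, hq, hqs⟩ := exists_mul_mem_setStab 0 hg.1.1 hg.2 (Nat.zero_le _)
    have hqc := Subgroup.mem_centralizer_singleton_iff.1 (lam.groupNPlus_le_centralizer 0 hq)
    -- With empty `λ⁻` the cut of index `0` is at `0`, so `q * g` sends positive integers to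
    -- positive ones.
    have hqD : q * g ∈ groupD n := by
      rw [mem_groupD_iff (mul_mem (lam.groupNPlus_le_groupB 0 hq) hg.1.1)]
      refine signProd_of_pos fun x hx => ?_
      have h0 := hqs 0 le_rfl (Nat.zero_le _) x
      rw [cut_zero, hlam] at h0
      exact h0.2 hx
    exact ⟨q, ⟨hq, (Subgroup.mul_mem_cancel_right _ hg.1).1 hqD⟩, mem_centralizerIn.2
      ⟨lam.mem_cutStab_cuts.2 ⟨hqD, fun i hi => hqs i (Nat.zero_le _) hi⟩,
      Commute.mul_left hqc hg.2⟩⟩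

/-- An odd part `m` provides the generator `t(o_m, m)` of sign `-1`, so the sign character is
nontrivial on `N_λ`. -/
theorem relIndex_groupN_inf (h : ¬ EvenParts lam.pos) :
    (lam.groupN ⊓ groupD n).relIndex lam.groupN = 2 := by
  rw [Subgroup.inf_relIndex_left, ← groupNPlus_zero, ← lam.negPartialSum_zero,
    Subgroup.relIndex_eq_two_iff]
  simp only [EvenParts, not_forall, exists_prop] at h
  obtain ⟨m, hm, hodd⟩ := h
  obtain ⟨j, hj, rfl⟩ := List.getElem_of_mem hm
  obtain ⟨i, hij, hi, hmem⟩ := exists_blockNeg_mem (lam.negPartialSum 0) hj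
  have hsign := lam.signProd_generator 0 (j := i) (by lia)
  rw [hi, lam.negPartialSum_zero, pow_zero, one_pow, one_mul,
    (Nat.not_even_iff_odd.1 hodd).neg_one_pow] at hsign
  rw [lam.negPartialSum_zero] at hmem ⊢
  have hNB : lam.groupNPlus 0 ≤ groupB n := lam.negPartialSum_zero ▸ lam.groupNPlus_le_groupB 0
  refine ⟨_, hmem, fun b hb => ?_⟩
  rw [mem_groupD_iff (mul_mem (hNB hb) (hNB hmem)), mem_groupD_iff (hNB hb),
    signProd_mul (hNB hb) (hNB hmem), hsign]
  have hb' : signProd n b = 1 ∨ signProd n b = -1 := by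
    rw [signProd, prod_sign_eq (hNB hb)]
    exact neg_one_pow_eq_or ℤ _
  rcases hb' with hb' | hb' <;> rw [hb'] <;> unfold Xor <;> norm_num

/-- At an odd part, the partial sums just before and just after it have opposite parity; the empty
sum is even, so it is never the one chosen. -/
theorem exists_odd_negPartialSum (h : ¬ EvenParts lam.neg) :
    ∃ j : ℕ, 1 ≤ j ∧ j ≤ lam.neg.length ∧ Odd (lam.negPartialSum j) := by
  simp only [EvenParts, not_forall, exists_prop] at h
  obtain ⟨m, hm, hodd⟩ := h
  obtain ⟨j, hj, rfl⟩ := List.getElem_of_mem hm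
  rw [Nat.not_even_iff_odd] at hodd
  by_cases hs : Odd (lam.negPartialSum j)
  · refine ⟨j, ?_, hj.le, hs⟩
    by_contra h0
    obtain rfl : j = 0 := by lia
    rw [negPartialSum_zero] at hs
    exact absurd hs (by decide)
  · refine ⟨j + 1, by lia, hj, ?_⟩
    rw [negPartialSum, sum_take_succ _ hj]
    exact (Nat.not_odd_iff_even.1 hs).add_odd hodd

end DoublePartition

end SignedPerm

theorem mainTheorem10 (n : ℕ) (hn : 4 ≤ n) (lam : SignedPerm.DoublePartition n)
    (hlam : Even lam.neg.length) :
    (SignedPerm.EvenParts lam.pos →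
      SignedPerm.IsComplementIn lam.groupN
        (SignedPerm.centralizerIn (SignedPerm.parabolicD n lam.rep) lam.rep)
        (SignedPerm.centralizerIn (SignedPerm.groupD n) lam.rep)) ∧
    (¬ SignedPerm.EvenParts lam.pos → lam.neg = [] →
      (lam.groupN ⊓ SignedPerm.groupD n).relIndex lam.groupN = 2 ∧
      SignedPerm.IsComplementIn (lam.groupN ⊓ SignedPerm.groupD n)
        (SignedPerm.centralizerIn (SignedPerm.parabolicD n lam.rep) lam.rep)
        (SignedPerm.centralizerIn (SignedPerm.groupD n) lam.rep)) ∧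
    (¬ SignedPerm.EvenParts lam.neg →
      (∃ j : ℕ, 1 ≤ j ∧ j ≤ lam.neg.length ∧ Odd (lam.negPartialSum j)) ∧
      ∀ j : ℕ, 1 ≤ j → j ≤ lam.neg.length → Odd (lam.negPartialSum j) →
        SignedPerm.IsComplementIn (lam.groupNPlus (lam.negPartialSum j))
          (SignedPerm.centralizerIn (SignedPerm.parabolicD n lam.rep) lam.rep)
          (SignedPerm.centralizerIn (SignedPerm.groupD n) lam.rep)) := by
  have h2 : 2 ≤ n := by lia
  refine ⟨fun h => ?_, fun h hneg => ⟨lam.relIndex_groupN_inf h, ?_⟩, fun h => ⟨?_, ?_⟩⟩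
  · rw [← lam.groupNPlus_zero, ← lam.negPartialSum_zero]
    exact lam.isComplementIn_groupNPlus h2 hlam (Or.inr ⟨lam.negPartialSum_zero, h⟩)
  · exact lam.isComplementIn_groupN_inf h2 hneg
  · exact lam.exists_odd_negPartialSum h
  · exact fun j _ _ hodd => lam.isComplementIn_groupNPlus h2 hlam (Or.inl hodd)
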